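/- Consider the scalar differential equation $$x' = a(t)\,|x| + b(t), \qquad (\ast)$$ where $a,b\in\mathbb{R}[\sin t,\cos t]$ are real trigonometric polynomials and every real zero of $b$ is simple. For $x\in\mathbb{R}$ let $u(t,x)$, $t\in\mathbb{R}$, denote the unique solution of $(\ast)$ with $u(0,x)=x$. Assume that there is a nonempty open interval $(x_1,x_2)\subset\mathbb{R}$ such that, for every $x\in(x_1,x_2)$, the function $t\mapsto u(t,x)$ has exactly two zeros $t_1(x)<t_2(x)$ in $(0,2\pi)$, both of them simple, and such that $$\lim_{x\to x_1^+}\bigl(t_2(x)-t_1(x)\bigr)=0 \quad\text{or}\quad \lim_{x\to x_2^-}\bigl(t_2(x)-t_1(x)\bigr)=0 .$$ Then $(\ast)$ has a global center, that is, every solution of $(\ast)$ is periodic in the sense that $x(0)=x(2\pi)$ (equivalently, is $2\pi$-periodic), if and only if there exist polynomials $P,Q\in\mathbb{R}[x]$ and a real trigonometric polynomial $h\in\mathbb{R}[\sin t,\cos t]$ such that, for all $t\in\mathbb{R}$, $$a(t)=P(h(t))\,h'(t),\qquad b(t)=Q(h(t))\,h'(t).$$ -/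

import Mathlib

open Filter Topology Set

/-- `f` is a real trigonometric polynomial: it lies in `ℝ[sin t, cos t]`. -/
def IsTrigPoly (f : ℝ → ℝ) : Prop :=
  f ∈ Algebra.adjoin ℝ ({Real.sin, Real.cos} : Set (ℝ → ℝ))

/-- All the zeros of `f` are simple. -/
def HasSimpleZeros (f : ℝ → ℝ) : Prop :=
  ∀ t, f t = 0 → deriv f t ≠ 0

/-- `φ` is a solution, on the whole line, of `x' = a(t)|x| + b(t)`. For continuous `a`, `b` the
right-hand side is globally Lipschitz in `x` on bounded time intervals, so these are exactly the
maximal solutions, and there is exactly one with a given value at `t = 0`. -/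
def IsSolution (a b : ℝ → ℝ) (φ : ℝ → ℝ) : Prop :=
  ∀ t, HasDerivAt φ (a t * |φ t| + b t) t

/-- The `2π`-periodic equation `x' = a(t)|x| + b(t)` has a global center: every solution is
periodic, that is, takes the same value at `0` and at `2π`. -/
def HasGlobalCenter (a b : ℝ → ℝ) : Prop :=
  ∀ φ : ℝ → ℝ, IsSolution a b φ → φ 0 = φ (2 * Real.pi)

/-- `s < t` are the zeros of `φ` in `(0, 2π)`, there are no others, and both are simple. -/
def HasExactlyTwoSimpleZeros (φ : ℝ → ℝ) (s t : ℝ) : Prop :=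
  s < t ∧ {r ∈ Ioo 0 (2 * Real.pi) | φ r = 0} = {s, t} ∧ deriv φ s ≠ 0 ∧ deriv φ t ≠ 0

/-- There is a nonempty open interval `(x₁, x₂)` such that for every `x` in it the solution with
value `x` at time `0` has exactly two zeros `t₁ x < t₂ x` in `(0, 2π)`, both simple, and these
merge as `x` tends to one of the endpoints. -/
def TwoMergingZeros (a b : ℝ → ℝ) : Prop :=
  ∃ x₁ x₂ : ℝ, x₁ < x₂ ∧ ∃ t₁ t₂ : ℝ → ℝ,
    (∀ x ∈ Ioo x₁ x₂, ∃ φ : ℝ → ℝ, IsSolution a b φ ∧ φ 0 = x ∧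
      HasExactlyTwoSimpleZeros φ (t₁ x) (t₂ x)) ∧
    (Tendsto (fun x => t₂ x - t₁ x) (𝓝[>] x₁) (𝓝 0) ∨
      Tendsto (fun x => t₂ x - t₁ x) (𝓝[<] x₂) (𝓝 0))

/-- The composition condition: `a = P(h) h'` and `b = Q(h) h'` with real polynomials `P`, `Q` and
a real trigonometric polynomial `h`. -/
def CompositionCondition (a b : ℝ → ℝ) : Prop :=
  ∃ (P Q : Polynomial ℝ) (h : ℝ → ℝ), IsTrigPoly h ∧
    ∀ t, a t = P.eval (h t) * deriv h t ∧ b t = Q.eval (h t) * deriv h t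

/-!
# Global centers of `x' = a(t)|x| + b(t)` and the composition condition

If `a = P(h) h'` and `b = Q(h) h'`, every solution has the form `X ∘ h`, where `X' = P|X| + Q`, and
is periodic like `h` (`CompositionCondition.hasGlobalCenter`).

Conversely, assume that all solutions are periodic. By the symmetry `(a, b, x) ↦ (-a, -b, -x)` the
initial values may be taken positive. A solution with two zeros `t₁ < t₂` is then positive, negative
and positive again, and solves an explicit linear equation on each of the three intervals. With
`A = ∫ a`, this shows that the primitives of `b exp A` and of `b exp (-A)` take equal values at
`t₁` and `t₂`. Comparing the derivatives with respect to the initial value yields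
`A(t₁) = A(t₂)`, and comparing them once more yields `(b / a)(t₁) = (b / a)(t₂)`. That the zeros
merge removes the constants of integration, and in particular `A` is `2π`-periodic
(`TwoMergingZeros.hasIdentifiedPairs`).

The rest is algebra. In the variable `z = exp (i t)`, trigonometric polynomials are Laurent
polynomials. The rational functions in `z` which take equal values at `t₁` and `t₂`, for initial
values close to the end of the interval where the zeros merge, form a subfield of `ℂ(z)`
(`pairingField`), which contains `A` and `b / a`. By Lüroth's theorem it is generated by a single
`r`, and `r` may be assumed to have a pole at `z = 0`. As `A` has a pole at `0` and no other pole in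
`ℂ \ {0}`, neither has `r`. Moreover `r` takes every complex value at some `z ≠ 0`: otherwise it
would have the form `y + κ z⁻ʲ`, and the power `zʲ` would take equal values at `t₁` and `t₂`, which
is impossible for `0 < t₂ - t₁ < 2π / j`. Hence a Laurent polynomial in the field is a polynomial in
`r` (`IsLaurentGenerator.exists_eq_eval`); the conjugate of `r` on the unit circle is such a
Laurent polynomial, and it follows that `r` can be replaced by a real trigonometric polynomial `h`
(`IsLaurentGenerator.exists_real`). So `A` is a polynomial in `h`. Finally, `b dt = Q(h) dh` with a
rational function `Q`, which has no poles because a pole of `Q` would be a pole of `b`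
(`IsLaurentGenerator.exists_eq_eval_mul_deriv`).

If `a = 0`, then `h = ∫ b` will do.
-/

/-! ### Rational functions identified along a family of pairs of points -/

section Pairing

open Polynomial

variable {ι K : Type*} [Field K] {l : Filter ι} {u v : ι → K}

theorem eventually_eval_ne_zero (hu : Tendsto u l cofinite) {p : K[X]} (hp : p ≠ 0) :
    ∀ᶠ i in l, p.eval (u i) ≠ 0 := by
  classical
  have h : {x | p.eval x = 0}.Finite := by
    refine (p.roots.toFinset.finite_toSet).subset fun x hx => ?_
    simpa [hp] using hx
  exact hu.eventually h.compl_mem_cofinite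

theorem eventually_denom_ne_zero (hu : Tendsto u l cofinite) (f : RatFunc K) :
    ∀ᶠ i in l, f.denom.eval₂ (RingHom.id K) (u i) ≠ 0 :=
  eventually_eval_ne_zero hu f.denom_ne_zero

/-- The field of rational functions `f` with `f (u i) = f (v i)` for almost all `i` along the
filter `l`. Since `u` and `v` eventually avoid every given point, the conventional value of
`RatFunc.eval` at a pole plays no role. -/
noncomputable def pairingField (hu : Tendsto u l cofinite) (hv : Tendsto v l cofinite) :
    IntermediateField K (RatFunc K) where
  carrier := {f | ∀ᶠ i in l, f.eval (RingHom.id K) (u i) = f.eval (RingHom.id K) (v i)}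
  mul_mem' {f g} hf hg := by
    filter_upwards [hf, hg, eventually_denom_ne_zero hu f, eventually_denom_ne_zero hu g,
      eventually_denom_ne_zero hv f, eventually_denom_ne_zero hv g] with i h1 h2 h3 h4 h5 h6
    rw [RatFunc.eval_mul _ _ h3 h4, RatFunc.eval_mul _ _ h5 h6, h1, h2]
  add_mem' {f g} hf hg := by
    filter_upwards [hf, hg, eventually_denom_ne_zero hu f, eventually_denom_ne_zero hu g,
      eventually_denom_ne_zero hv f, eventually_denom_ne_zero hv g] with i h1 h2 h3 h4 h5 h6
    rw [RatFunc.eval_add _ _ h3 h4, RatFunc.eval_add _ _ h5 h6, h1, h2]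
  algebraMap_mem' c := by
    refine Eventually.of_forall fun i => ?_
    rw [RatFunc.algebraMap_eq_C, RatFunc.eval_C, RatFunc.eval_C]
  inv_mem' f hf := by
    by_cases h0 : f = 0
    · subst h0; simp
    show ∀ᶠ i in l, _
    filter_upwards [hf, eventually_denom_ne_zero hu f, eventually_denom_ne_zero hu f⁻¹,
      eventually_denom_ne_zero hv f, eventually_denom_ne_zero hv f⁻¹] with i h1 h2 h3 h4 h5
    have e1 := RatFunc.eval_mul _ _ h2 h3
    have e2 := RatFunc.eval_mul _ _ h4 h5
    rw [mul_inv_cancel₀ h0, RatFunc.eval_one] at e1 e2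
    rw [eq_inv_of_mul_eq_one_right e1.symm, eq_inv_of_mul_eq_one_right e2.symm, h1]

theorem div_mem_pairingField_iff {hu : Tendsto u l cofinite} {hv : Tendsto v l cofinite}
    (f : K[X]) {g : K[X]} (hg : g ≠ 0) :
    algebraMap K[X] (RatFunc K) f / algebraMap K[X] (RatFunc K) g ∈ pairingField hu hv ↔
      ∀ᶠ i in l, f.eval (u i) * g.eval (v i) = f.eval (v i) * g.eval (u i) := by
  set F := algebraMap K[X] (RatFunc K) f / algebraMap K[X] (RatFunc K) g with hF
  have hFg : F * algebraMap K[X] (RatFunc K) g = algebraMap K[X] (RatFunc K) f :=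
    div_mul_cancel₀ _ (RatFunc.algebraMap_ne_zero hg)
  have key : ∀ {w : ι → K}, Tendsto w l cofinite → ∀ᶠ i in l,
      F.eval (RingHom.id K) (w i) * g.eval (w i) = f.eval (w i) := fun {w} hw => by
    filter_upwards [eventually_denom_ne_zero hw F] with i h
    have e := RatFunc.eval_mul (RingHom.id K) (w i) h
      (y := algebraMap K[X] (RatFunc K) g) (by simp)
    rw [hFg] at e
    simpa [RatFunc.eval_algebraMap, Polynomial.eval₂_id] using e.symm
  have : F ∈ pairingField hu hv ↔
      ∀ᶠ i in l, F.eval (RingHom.id K) (u i) = F.eval (RingHom.id K) (v i) := Iff.rfl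
  rw [this]
  refine eventually_congr ?_
  filter_upwards [key hu, key hv, eventually_eval_ne_zero hu hg, eventually_eval_ne_zero hv hg]
    with i h1 h2 h3 h4
  rw [← h1, ← h2]
  constructor
  · intro h; rw [h]; ring
  · intro h
    have h' : (F.eval (RingHom.id K) (u i) - F.eval (RingHom.id K) (v i)) *
      (g.eval (u i) * g.eval (v i)) = 0 := by linear_combination h
    exact sub_eq_zero.1 ((mul_eq_zero.1 h').resolve_right (mul_ne_zero h3 h4))

/-- Lüroth's theorem, with the generator moved by a Möbius transformation so that it has a pole at
the origin. -/
theorem exists_generator_denom_eval_zero (E : IntermediateField K (RatFunc K)) (hE : E ≠ ⊥) :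
    ∃ r : RatFunc K, E = IntermediateField.adjoin K {r} ∧ r.denom.eval 0 = 0 := by
  set g := RatFunc.Luroth.generator E with hg
  have hEg : E = IntermediateField.adjoin K {g} := RatFunc.Luroth.eq_adjoin_generator
  by_cases h0 : g.denom.eval 0 = 0
  · exact ⟨g, hEg, h0⟩
  set c : K := g.num.eval 0 / g.denom.eval 0 with hc
  set C' := algebraMap K (RatFunc K) c with hC'
  have hgc : g - C' ≠ 0 := fun h => RatFunc.Luroth.generator_ne_C hE ⟨c, by
    rw [← hg, sub_eq_zero.1 h, hC', RatFunc.algebraMap_eq_C]⟩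
  refine ⟨(g - C')⁻¹, ?_, ?_⟩
  · rw [hEg]
    refine le_antisymm ?_ ?_ <;> rw [IntermediateField.adjoin_simple_le_iff]
    · have h := IntermediateField.mem_adjoin_simple_self K (g - C')⁻¹
      have h2 := add_mem (inv_mem h)
        (algebraMap_mem (IntermediateField.adjoin K {(g - C')⁻¹}) c)
      simpa [hC'] using h2
    · exact inv_mem (sub_mem (IntermediateField.mem_adjoin_simple_self K g) (algebraMap_mem _ c))
  · set r := (g - C')⁻¹ with hr
    have e1 : r * (g - C') = 1 := inv_mul_cancel₀ hgc
    have hgd : algebraMap K[X] (RatFunc K) g.denom ≠ 0 :=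
      RatFunc.algebraMap_ne_zero g.denom_ne_zero
    have hrd : algebraMap K[X] (RatFunc K) r.denom ≠ 0 :=
      RatFunc.algebraMap_ne_zero r.denom_ne_zero
    have e2 : algebraMap K[X] (RatFunc K) (r.num * (g.num - Polynomial.C c * g.denom)) =
        algebraMap K[X] (RatFunc K) (g.denom * r.denom) := by
      have hC : algebraMap K[X] (RatFunc K) (Polynomial.C c) = C' := by
        rw [RatFunc.algebraMap_C, hC', RatFunc.algebraMap_eq_C]
      rw [map_mul, map_mul, map_sub, map_mul, hC]
      have a1 := RatFunc.num_div_denom r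
      have a2 := RatFunc.num_div_denom g
      rw [div_eq_iff hrd] at a1
      rw [div_eq_iff hgd] at a2
      rw [a1, a2]
      linear_combination algebraMap K[X] (RatFunc K) r.denom *
        algebraMap K[X] (RatFunc K) g.denom * e1
    have e3 := congrArg (Polynomial.eval 0) (RatFunc.algebraMap_injective K e2)
    simp only [Polynomial.eval_mul, Polynomial.eval_sub, Polynomial.eval_C, hc,
      div_mul_cancel₀ _ h0, sub_self, mul_zero] at e3
    exact (mul_eq_zero.1 e3.symm).resolve_left h0

end Pairing

/-! ### Homogenization of a polynomial at a pair of polynomials -/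

section Homogenization

open Polynomial

variable {K : Type*} [Field K]

/-- The homogenization of degree `m` of `p`, evaluated at `(N, D)`: it is `D ^ m * p (N / D)` when
`m` is at least the degree of `p`. -/
noncomputable def homogEval (p N D : K[X]) (m : ℕ) : K[X] :=
  ∑ i ∈ Finset.range (m + 1), C (p.coeff i) * N ^ i * D ^ (m - i)

theorem map_homogEval {L : Type*} [Field L] (φ : K[X] →+* L) {p : K[X]} (N : K[X]) {D : K[X]}
    {m : ℕ} (hp : p.natDegree ≤ m) (hD : φ D ≠ 0) :
    φ (homogEval p N D m) = φ D ^ m * p.eval₂ (φ.comp C) (φ N / φ D) := by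
  rw [homogEval, map_sum, Polynomial.eval₂_eq_sum_range' (φ.comp C) (Nat.lt_succ_of_le hp),
    Finset.mul_sum]
  refine Finset.sum_congr rfl fun i hi => ?_
  have hi' : i ≤ m := Nat.lt_succ_iff.1 (Finset.mem_range.1 hi)
  rw [map_mul, map_mul, map_pow, map_pow, div_pow, RingHom.comp_apply]
  obtain ⟨k, rfl⟩ := Nat.exists_eq_add_of_le hi'
  rw [Nat.add_sub_cancel_left, pow_add]
  field_simp

theorem eval_homogEval {p : K[X]} (N : K[X]) {D : K[X]} {m : ℕ} (hp : p.natDegree ≤ m) {z : K}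
    (hD : D.eval z ≠ 0) :
    (homogEval p N D m).eval z = D.eval z ^ m * p.eval (N.eval z / D.eval z) := by
  have h := map_homogEval (evalRingHom z) N hp (by simpa using hD)
  have hC : (evalRingHom z).comp C = RingHom.id K := by ext; simp
  rw [hC] at h
  simpa using h

theorem eval_homogEval_of_eval_eq_zero (p N : K[X]) {D : K[X]} (m : ℕ) {z : K}
    (hD : D.eval z = 0) :
    (homogEval p N D m).eval z = p.coeff m * N.eval z ^ m := by
  rw [homogEval, eval_finsetSum, Finset.sum_range_succ, Finset.sum_eq_zero]
  · simp
  · intro i hi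
    have : m - i ≠ 0 := by have := Finset.mem_range.1 hi; omega
    simp [hD, this]

theorem exists_homogEval_eq {r : RatFunc K} {f g : K[X]} (hg : g ≠ 0)
    (h : algebraMap K[X] (RatFunc K) f / algebraMap K[X] (RatFunc K) g ∈
      IntermediateField.adjoin K {r}) :
    ∃ p q : K[X], IsCoprime p q ∧ q ≠ 0 ∧ ∀ m, p.natDegree ≤ m → q.natDegree ≤ m →
      f * homogEval q r.num r.denom m = g * homogEval p r.num r.denom m := by
  obtain ⟨p₀, q₀, h0⟩ := (IntermediateField.mem_adjoin_simple_iff K _).1 h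
  have hg' := RatFunc.algebraMap_ne_zero (K := K) hg
  obtain ⟨p, q, hpq, hq0, hq⟩ : ∃ p q : K[X], IsCoprime p q ∧ q ≠ 0 ∧
      algebraMap K[X] (RatFunc K) f * aeval r q = algebraMap K[X] (RatFunc K) g * aeval r p := by
    by_cases hz : aeval r q₀ = 0
    · refine ⟨0, 1, isCoprime_one_right, one_ne_zero, ?_⟩
      rw [hz, div_zero, div_eq_zero_iff] at h0
      simp [h0.resolve_right hg']
    · have hq₀ : q₀ ≠ 0 := by rintro rfl; simp at hz
      have hq₀' := RatFunc.algebraMap_ne_zero (K := K) hq₀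
      set w := algebraMap K[X] (RatFunc K) p₀ / algebraMap K[X] (RatFunc K) q₀ with hw
      have hwd := RatFunc.algebraMap_ne_zero (K := K) w.denom_ne_zero
      have e : w.num * q₀ = p₀ * w.denom := by
        apply RatFunc.algebraMap_injective K
        rw [map_mul, map_mul, ← div_eq_div_iff hwd hq₀', RatFunc.num_div_denom]
      refine ⟨w.num, w.denom, w.isCoprime_num_denom, w.denom_ne_zero, ?_⟩
      have e' := congrArg (aeval r) e
      rw [map_mul, map_mul] at e'
      rw [div_eq_div_iff hg' hz] at h0
      refine mul_right_cancel₀ hz ?_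
      linear_combination aeval r w.denom * h0 - algebraMap K[X] (RatFunc K) g * e'
  refine ⟨p, q, hpq, hq0, fun m hpm hqm => ?_⟩
  apply RatFunc.algebraMap_injective K
  have hd : algebraMap K[X] (RatFunc K) r.denom ≠ 0 := RatFunc.algebraMap_ne_zero r.denom_ne_zero
  rw [map_mul, map_mul, map_homogEval (algebraMap K[X] (RatFunc K)) _ hqm hd,
    map_homogEval (algebraMap K[X] (RatFunc K)) _ hpm hd, RatFunc.num_div_denom]
  have e : ∀ s : K[X], s.eval₂ ((algebraMap K[X] (RatFunc K)).comp C) r = aeval r s := fun s => by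
    rw [aeval_def]; congr 1
  rw [e, e]
  linear_combination algebraMap K[X] (RatFunc K) r.denom ^ m * hq

end Homogenization

/-! ### A Laurent polynomial generating the identified functions -/

section Generator

open Polynomial

variable {ι K : Type*} [Field K] {l : Filter ι} {u v : ι → K}

theorem eq_C_of_forall_eval_ne_zero [IsAlgClosed K] {p : K[X]} (h : ∀ z, p.eval z ≠ 0) :
    p = C (p.coeff 0) := by
  refine eq_C_of_degree_le_zero ?_
  by_contra hd
  obtain ⟨z, hz⟩ := IsAlgClosed.exists_root p (fun h0 => hd h0.le)
  exact h z hz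

theorem eq_C_mul_X_pow_of_eval_ne_zero [IsAlgClosed K] {D : K[X]} (hD : D ≠ 0)
    (h : ∀ z, z ≠ 0 → D.eval z ≠ 0) : ∃ (c : K) (j : ℕ), c ≠ 0 ∧ D = C c * X ^ j := by
  obtain ⟨q, hq, hdvd⟩ := exists_eq_pow_rootMultiplicity_mul_and_not_dvd D hD 0
  rw [dvd_iff_isRoot, IsRoot.def] at hdvd
  have hq0 : ∀ z, q.eval z ≠ 0 := fun z hz => by
    by_cases hz0 : z = 0
    · exact hdvd (hz0 ▸ hz)
    · exact h z hz0 (by rw [hq]; simp [hz])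
  refine ⟨q.coeff 0, rootMultiplicity 0 D, ?_, ?_⟩
  · intro h0
    exact hdvd (by rw [eq_C_of_forall_eval_ne_zero hq0, h0]; simp)
  · rw [← eq_C_of_forall_eval_ne_zero hq0, mul_comm]
    simpa using hq

variable (l u v) in
/-- `N / X ^ j` is a Laurent polynomial with a pole at the origin, identified along the pairs
`(u i, v i)`, and every rational function `f / g` identified along these pairs is a rational
function `p / q` of it. -/
structure IsLaurentGenerator (N : K[X]) (j : ℕ) : Prop where
  pos : 0 < j
  eval_zero_ne : N.eval 0 ≠ 0
  paired : ∀ᶠ i in l, N.eval (u i) * v i ^ j = N.eval (v i) * u i ^ j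
  exists_coprime : ∀ f g : K[X], g ≠ 0 →
    (∀ᶠ i in l, f.eval (u i) * g.eval (v i) = f.eval (v i) * g.eval (u i)) →
    ∃ p q : K[X], IsCoprime p q ∧ q ≠ 0 ∧ ∀ z, z ≠ 0 →
      f.eval z * q.eval (N.eval z / z ^ j) = g.eval z * p.eval (N.eval z / z ^ j)

/-- A Laurent polynomial of the form `y + κ / X ^ j` would identify the powers `u i ^ j` and
`v i ^ j`; hence a generator omits no value. -/
theorem exists_eval_eq_of_paired [IsAlgClosed K]
    (hpow : ∀ k, 0 < k → ¬ ∀ᶠ i in l, u i ^ k = v i ^ k) {N : K[X]} {j : ℕ} (hj : 0 < j)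
    (hN : N.eval 0 ≠ 0) (hp : ∀ᶠ i in l, N.eval (u i) * v i ^ j = N.eval (v i) * u i ^ j) (y : K) :
    ∃ z, z ≠ 0 ∧ N.eval z = y * z ^ j := by
  by_contra hcon
  push Not at hcon
  have h : ∀ z, (N - C y * X ^ j).eval z ≠ 0 := fun z hz => by
    simp only [eval_sub, eval_mul, eval_C, eval_pow, eval_X] at hz
    by_cases hz0 : z = 0
    · subst hz0; rw [zero_pow hj.ne', mul_zero, sub_zero] at hz; exact hN hz
    · exact hcon z hz0 (sub_eq_zero.1 hz)
  have hc := eq_C_of_forall_eval_ne_zero h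
  set κ := (N - C y * X ^ j).coeff 0 with hκ
  have hκ0 : κ ≠ 0 := by
    have := h 0
    rwa [hc, eval_C] at this
  have hNz : ∀ z, N.eval z = y * z ^ j + κ := fun z => by
    have := congrArg (eval z) hc
    simp only [eval_sub, eval_mul, eval_C, eval_pow, eval_X] at this
    linear_combination this
  refine hpow j hj ?_
  filter_upwards [hp] with i hi
  rw [hNz, hNz] at hi
  exact mul_left_cancel₀ hκ0 (by linear_combination -hi)

/-- Existence of a Laurent polynomial generator, given a Laurent polynomial `M / X ^ n` with a pole
at `0` which is identified along the pairs. The generator `r` provided by Lüroth's theorem is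
normalized to have a pole at `0`. If `M / X ^ n = p(r) / q(r)`, then `p / q` has a pole at `∞`, and
so `M / X ^ n` has a pole wherever `r` has one, which is only at the origin. -/
theorem exists_isLaurentGenerator [IsAlgClosed K] (hu : Tendsto u l cofinite)
    (hv : Tendsto v l cofinite) {M : K[X]} {n : ℕ} (hn : 0 < n) (hM : M.eval 0 ≠ 0)
    (hpair : ∀ᶠ i in l, M.eval (u i) * v i ^ n = M.eval (v i) * u i ^ n) :
    ∃ (N : K[X]) (j : ℕ), IsLaurentGenerator l u v N j := by
  set E := pairingField hu hv with hE
  have hXn : (X ^ n : K[X]) ≠ 0 := pow_ne_zero _ X_ne_zero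
  have hA : algebraMap K[X] (RatFunc K) M / algebraMap K[X] (RatFunc K) (X ^ n) ∈ E := by
    rw [hE, div_mem_pairingField_iff _ hXn]
    simpa using hpair
  have hEbot : E ≠ ⊥ := fun h => by
    rw [h, IntermediateField.mem_bot] at hA
    obtain ⟨c, hc⟩ := hA
    rw [eq_div_iff (RatFunc.algebraMap_ne_zero hXn), RatFunc.algebraMap_eq_C,
      ← RatFunc.algebraMap_C, ← map_mul] at hc
    have := congrArg (eval 0) (RatFunc.algebraMap_injective K hc)
    simp only [eval_mul, eval_pow, eval_X, zero_pow hn.ne', mul_zero] at this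
    exact hM this.symm
  obtain ⟨r, hr, hr0⟩ := exists_generator_denom_eval_zero E hEbot
  have hcop : ∀ z, r.denom.eval z = 0 → r.num.eval z ≠ 0 := fun z hd hz => by
    obtain ⟨s, t, hst⟩ := r.isCoprime_num_denom
    have := congrArg (eval z) hst
    simp [hd, hz] at this
  have hroots : ∀ z, z ≠ 0 → r.denom.eval z ≠ 0 := by
    intro z hz hdz
    rw [hr] at hA
    obtain ⟨p, q, -, hq0, hpq⟩ := exists_homogEval_eq hXn hA
    set m := max p.natDegree q.natDegree with hm
    have h := hpq m (le_max_left _ _) (le_max_right _ _)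
    have h0 := congrArg (eval 0) h
    have hz' := congrArg (eval z) h
    simp only [eval_mul, eval_homogEval_of_eval_eq_zero _ _ _ hr0,
      eval_homogEval_of_eval_eq_zero _ _ _ hdz, eval_pow, eval_X, zero_pow hn.ne', zero_mul]
      at h0 hz'
    have hqm : q.coeff m = 0 := by
      simpa [hM, hcop 0 hr0] using h0
    have hpm : p.coeff m = 0 := by
      rw [hqm] at hz'
      simpa [hz, hcop z hdz] using hz'
    rcases le_total p.natDegree q.natDegree with hle | hle
    · rw [hm, max_eq_right hle, coeff_natDegree, leadingCoeff_eq_zero] at hqm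
      exact hq0 hqm
    · rw [hm, max_eq_left hle, coeff_natDegree, leadingCoeff_eq_zero] at hpm
      rw [hpm, natDegree_zero] at hle
      rw [hm, hpm, natDegree_zero, max_eq_right (Nat.zero_le _), coeff_natDegree,
        leadingCoeff_eq_zero] at hqm
      exact hq0 hqm
  obtain ⟨c, j, hc, hD⟩ := eq_C_mul_X_pow_of_eval_ne_zero r.denom_ne_zero hroots
  have hj : 0 < j := by
    rw [Nat.pos_iff_ne_zero]
    rintro rfl
    rw [hD] at hr0
    simp [hc] at hr0
  have hval : ∀ z, (C c⁻¹ * r.num).eval z / z ^ j = r.num.eval z / r.denom.eval z := fun z => by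
    rw [hD]
    simp only [eval_mul, eval_C, eval_pow, eval_X]
    rw [div_mul_eq_div_div, inv_mul_eq_div]
  refine ⟨C c⁻¹ * r.num, j, hj, ?_, ?_, ?_⟩
  · simpa [hc] using hcop 0 hr0
  · have hmem : algebraMap K[X] (RatFunc K) r.num / algebraMap K[X] (RatFunc K) r.denom ∈ E := by
      rw [RatFunc.num_div_denom, hr]
      exact IntermediateField.mem_adjoin_simple_self K r
    rw [hE, div_mem_pairingField_iff _ r.denom_ne_zero, hD] at hmem
    filter_upwards [hmem] with i hi
    simp only [eval_mul, eval_C, eval_pow, eval_X] at hi ⊢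
    field_simp
    exact mul_left_cancel₀ hc (by linear_combination hi)
  · intro f g hg hfg
    have hmem : algebraMap K[X] (RatFunc K) f / algebraMap K[X] (RatFunc K) g ∈ E := by
      rw [hE, div_mem_pairingField_iff _ hg]
      exact hfg
    rw [hr] at hmem
    obtain ⟨p, q, hcpq, hq0, hpq⟩ := exists_homogEval_eq hg hmem
    refine ⟨p, q, hcpq, hq0, fun z hz => ?_⟩
    have h := congrArg (eval z) (hpq _ (le_max_left _ _) (le_max_right _ _))
    have hdz := hroots z hz
    rw [eval_mul, eval_mul, eval_homogEval _ (le_max_right _ _) hdz,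
      eval_homogEval _ (le_max_left _ _) hdz] at h
    rw [hval]
    exact mul_left_cancel₀ (pow_ne_zero _ hdz) (by linear_combination h)

namespace IsLaurentGenerator

variable {N : K[X]} {j : ℕ}

theorem affine (h : IsLaurentGenerator l u v N j) {c : K} (hc : c ≠ 0) (d : K) :
    IsLaurentGenerator l u v (C c * N + C d * X ^ j) j where
  pos := h.pos
  eval_zero_ne := by
    simpa [h.pos.ne', hc] using h.eval_zero_ne
  paired := by
    filter_upwards [h.paired] with i hi
    simp only [eval_add, eval_mul, eval_C, eval_pow, eval_X]
    linear_combination c * hi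
  exists_coprime f g hg hfg := by
    obtain ⟨p, q, hpq, hq, hz⟩ := h.exists_coprime f g hg hfg
    set L : K[X] := C c⁻¹ * (X - C d) with hL
    have hLc : L.comp (C c * X + C d) = X := by
      simp [hL, ← mul_assoc, ← C_mul, hc]
    refine ⟨p.comp L, q.comp L, ?_, ?_, fun z hz0 => ?_⟩
    · simpa using hpq.map (compRingHom L)
    · intro h0
      apply hq
      have := congrArg (fun s => s.comp (C c * X + C d)) h0
      simpa [comp_assoc, hLc] using this
    · have e : L.eval ((C c * N + C d * X ^ j).eval z / z ^ j) = N.eval z / z ^ j := by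
        simp only [hL, eval_mul, eval_C, eval_sub, eval_X, eval_add, eval_pow]
        field_simp
        ring
      rw [eval_comp, eval_comp, e]
      exact hz z hz0

/-- The functions identified along the pairs without poles outside the origin are the polynomials
in the generator. -/
theorem exists_eq_eval [IsAlgClosed K] (h : IsLaurentGenerator l u v N j)
    (hpow : ∀ k, 0 < k → ¬ ∀ᶠ i in l, u i ^ k = v i ^ k) {f : K[X]} {m : ℕ}
    (hf : ∀ᶠ i in l, f.eval (u i) * v i ^ m = f.eval (v i) * u i ^ m) :
    ∃ p : K[X], ∀ z, z ≠ 0 → f.eval z = z ^ m * p.eval (N.eval z / z ^ j) := by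
  obtain ⟨p, q, hpq, hq, hz⟩ := h.exists_coprime f (X ^ m) (pow_ne_zero _ X_ne_zero)
    (by simpa using hf)
  have hq0 : ∀ y, q.eval y ≠ 0 := by
    intro y hy
    obtain ⟨z, hz0, hzy⟩ := exists_eval_eq_of_paired hpow h.pos h.eval_zero_ne h.paired y
    have e := hz z hz0
    rw [hzy, mul_div_cancel_right₀ _ (pow_ne_zero _ hz0), hy] at e
    have hpy : p.eval y = 0 := by simpa [hz0] using e
    obtain ⟨s, t, hst⟩ := hpq
    have := congrArg (eval y) hst
    simp [hy, hpy] at this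
  have hqC := eq_C_of_forall_eval_ne_zero hq0
  have hc : q.coeff 0 ≠ 0 := fun h0 => hq (by rw [hqC, h0, C_0])
  refine ⟨C (q.coeff 0)⁻¹ * p, fun z hz0 => ?_⟩
  have e := hz z hz0
  rw [hqC] at e
  simp only [eval_C, eval_pow, eval_X, eval_mul] at e ⊢
  field_simp
  linear_combination e

/-- Up to a power of `X`, the polynomial `X N' - j N` is the derivative of the generator
`r = N / X ^ j`. If its quotient into `f` is identified along the pairs, so that `f dz = q(r) dr` up
to a power of `X` with a rational function `q`, then `q` is a polynomial: at a point where `r` takes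
the value of a pole of `q` with multiplicity `e`, the form `dr` vanishes only to the order `e - 1`.
-/
theorem exists_eq_eval_mul_deriv [IsAlgClosed K] [CharZero K] (h : IsLaurentGenerator l u v N j)
    (hpow : ∀ k, 0 < k → ¬ ∀ᶠ i in l, u i ^ k = v i ^ k) {f : K[X]} {m : ℕ}
    (hf : ∀ᶠ i in l,
      f.eval (u i) * (X ^ m * (X * derivative N - C (j : K) * N)).eval (v i) =
        f.eval (v i) * (X ^ m * (X * derivative N - C (j : K) * N)).eval (u i)) :
    ∃ p : K[X], ∀ z, z ≠ 0 → f.eval z =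
      (X ^ m * (X * derivative N - C (j : K) * N)).eval z * p.eval (N.eval z / z ^ j) := by
  set W : K[X] := X * derivative N - C (j : K) * N with hW
  have hj0 : (j : K) ≠ 0 := Nat.cast_ne_zero.2 h.pos.ne'
  have hW0 : W ≠ 0 := fun h0 => by
    have := congrArg (eval 0) h0
    simp [hW, hj0, h.eval_zero_ne] at this
  obtain ⟨p, q, hpq, hq, hz⟩ := h.exists_coprime f (X ^ m * W)
    (mul_ne_zero (pow_ne_zero _ X_ne_zero) hW0) hf
  have hq0 : ∀ y, q.eval y ≠ 0 := by
    intro y hy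
    obtain ⟨z, hz0, hzy⟩ := exists_eval_eq_of_paired hpow h.pos h.eval_zero_ne h.paired y
    have hpy : p.eval y ≠ 0 := fun hpy => by
      obtain ⟨s, t, hst⟩ := hpq
      have := congrArg (eval y) hst
      simp [hy, hpy] at this
    obtain ⟨q₁, hq₁⟩ := dvd_iff_isRoot.2 hy
    set G : K[X] := N - C y * X ^ j with hG
    set d := max p.natDegree q₁.natDegree with hd
    -- the identity `f q(r) = X ^ m W p(r)`, cleared of denominators
    have hid : f * (G * homogEval q₁ N (X ^ j) d) = X ^ m * W * homogEval p N (X ^ j) (d + 1) := by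
      refine Polynomial.eq_of_infinite_eval_eq _ _ ?_
      refine Set.Infinite.mono (s := {0}ᶜ) ?_ (Set.finite_singleton (0 : K)).infinite_compl
      intro w hw
      have hw0 : w ≠ 0 := hw
      have hXw : (X ^ j : K[X]).eval w ≠ 0 := by simpa using fun h' => absurd h' hw0
      have e := hz w hw0
      have hqw : q.eval (N.eval w / w ^ j) = (N.eval w / w ^ j - y) *
          q₁.eval (N.eval w / w ^ j) := by
        rw [hq₁]; simp
      rw [hqw] at e
      show eval w _ = eval w _
      rw [eval_mul, eval_mul, eval_homogEval N (le_max_right _ _) hXw, eval_mul,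
        eval_homogEval N ((le_max_left _ _).trans (Nat.le_succ _)) hXw, hG]
      simp only [eval_sub, eval_mul, eval_C, eval_pow, eval_X] at e ⊢
      rw [pow_succ]
      have hNw : N.eval w = N.eval w / w ^ j * w ^ j := by field_simp
      set ρ := N.eval w / w ^ j with hρ
      rw [hNw]
      linear_combination (w ^ j) ^ d * w ^ j * e
    have hG0 : G.eval z = 0 := by simp [hG, hzy]
    have hGne : G ≠ 0 := fun h0 => by
      have := congrArg (eval 0) h0
      simp [hG, h.pos.ne', h.eval_zero_ne] at this
    have hWG : W = X * derivative G - C (j : K) * G := by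
      have hXj : (X : K[X]) * X ^ (j - 1) = X ^ j := by
        rw [← pow_succ', Nat.sub_add_cancel h.pos]
      rw [hW, hG]
      simp only [derivative_sub, derivative_mul, derivative_C, derivative_X_pow, zero_mul,
        zero_add]
      linear_combination (C y * C (j : K)) * hXj
    set e := G.rootMultiplicity z with he
    have hdvd : (X - C z) ^ e ∣ G := pow_rootMultiplicity_dvd G z
    have hcopz : ∀ s : K[X], s.eval z ≠ 0 → IsCoprime ((X - C z) ^ e) s := fun s hs =>
      IsCoprime.pow_left ((irreducible_X_sub_C z).coprime_iff_not_dvd.2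
        (by rwa [dvd_iff_isRoot]))
    have hP : (homogEval p N (X ^ j) (d + 1)).eval z ≠ 0 := by
      have hXz : (X ^ j : K[X]).eval z ≠ 0 := by simpa using fun h' => absurd h' hz0
      rw [eval_homogEval N ((le_max_left _ _).trans (Nat.le_succ _)) hXz, hzy, eval_pow, eval_X,
        mul_div_cancel_right₀ _ (pow_ne_zero _ hz0)]
      exact mul_ne_zero (pow_ne_zero _ (pow_ne_zero _ hz0)) hpy
    have h1 : (X - C z) ^ e ∣ X ^ m * W * homogEval p N (X ^ j) (d + 1) := by
      rw [← hid]
      exact Dvd.dvd.mul_left (Dvd.dvd.mul_right hdvd _) _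
    have h2 : (X - C z) ^ e ∣ X ^ m * W := (hcopz _ hP).dvd_of_dvd_mul_right h1
    have h3 : (X - C z) ^ e ∣ W :=
      (hcopz _ (by simpa using fun h' => absurd h' hz0)).dvd_of_dvd_mul_left h2
    rw [hWG] at h3
    have h4 : (X - C z) ^ e ∣ X * derivative G :=
      (dvd_sub_left (Dvd.dvd.mul_left hdvd _)).1 h3
    have h5 : (X - C z) ^ e ∣ derivative G :=
      (hcopz _ (by simpa using hz0)).dvd_of_dvd_mul_left h4
    have hepos : 0 < e := (rootMultiplicity_pos hGne).2 hG0
    have hdG : derivative G ≠ 0 := fun h0 => by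
      have := derivative_eq_zero.1 h0
      rw [eq_C_of_natDegree_eq_zero this, eval_C] at hG0
      rw [eq_C_of_natDegree_eq_zero this, hG0, C_0] at hGne
      exact hGne rfl
    have h6 := (le_rootMultiplicity_iff hdG).2 h5
    rw [derivative_rootMultiplicity_of_root hG0] at h6
    omega
  have hqC := eq_C_of_forall_eval_ne_zero hq0
  have hc : q.coeff 0 ≠ 0 := fun h0 => hq (by rw [hqC, h0, C_0])
  refine ⟨C (q.coeff 0)⁻¹ * p, fun z hz0 => ?_⟩
  have e := hz z hz0
  rw [hqC] at e
  rw [eval_C] at e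
  generalize (X ^ m * W).eval z = w at e ⊢
  rw [eval_mul, eval_C]
  field_simp
  linear_combination e

end IsLaurentGenerator

end Generator

/-! ### Trigonometric polynomials as Laurent polynomials on the unit circle -/

section Trig

open Polynomial

/-- The parametrization `t ↦ exp (i t)` of the unit circle. -/
noncomputable def expI (t : ℝ) : ℂ := Complex.exp (t * Complex.I)

theorem expI_ne_zero (t : ℝ) : expI t ≠ 0 := Complex.exp_ne_zero _

theorem norm_expI (t : ℝ) : ‖expI t‖ = 1 := Complex.norm_exp_ofReal_mul_I t

theorem expI_eq (t : ℝ) : expI t = Real.cos t + Real.sin t * Complex.I := by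
  rw [expI, Complex.exp_mul_I, Complex.ofReal_cos, Complex.ofReal_sin]

theorem hasDerivAt_expI (t : ℝ) : HasDerivAt expI (Complex.I * expI t) t := by
  have h := ((Complex.ofRealCLM.hasDerivAt (x := t)).mul_const Complex.I).cexp
  simp only [Complex.ofRealCLM_apply, Complex.ofReal_one, one_mul] at h
  rw [mul_comm]
  exact h

theorem expI_injOn : InjOn expI (Ioo 0 (2 * Real.pi)) := by
  intro s hs t ht h
  obtain ⟨n, hn⟩ := Complex.exp_eq_exp_iff_exists_int.1 h
  have h1 : (s : ℂ) = ((t + n * (2 * Real.pi) : ℝ) : ℂ) := by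
    refine mul_right_cancel₀ Complex.I_ne_zero ?_
    push_cast
    linear_combination hn
  have h2 : s = t + n * (2 * Real.pi) := by exact_mod_cast h1
  have hpi := Real.pi_pos
  have hn1 : (n : ℝ) < 1 := by
    by_contra! hc
    nlinarith [hs.2, ht.1]
  have hn2 : (-1 : ℝ) < n := by
    by_contra! hc
    nlinarith [hs.1, ht.2]
  have hn0 : n = 0 := by
    have a1 : n < 1 := by exact_mod_cast hn1
    have a2 : -1 < n := by exact_mod_cast hn2
    omega
  simpa [hn0] using h2

theorem polynomial_eq_of_eval_expI {p q : ℂ[X]} (h : ∀ t, p.eval (expI t) = q.eval (expI t)) :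
    p = q := by
  refine Polynomial.eq_of_infinite_eval_eq p q ?_
  refine Set.Infinite.mono (s := expI '' Ioo 0 (2 * Real.pi)) ?_ ?_
  · rintro _ ⟨t, -, rfl⟩
    exact h t
  · exact (Ioo_infinite (by positivity)).image expI_injOn

/-- On the unit circle, complex conjugation turns a polynomial into a Laurent polynomial, the
conjugate of `z` being `1 / z`. -/
theorem exists_conj_eval (M : ℂ[X]) : ∃ (M' : ℂ[X]) (d : ℕ), M'.natDegree ≤ d ∧
    d = M.natDegree ∧
    ∀ t, (starRingEnd ℂ) (M.eval (expI t)) * expI t ^ d = M'.eval (expI t) := by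
  set R := M.map (starRingEnd ℂ) with hR
  refine ⟨R.reverse, R.natDegree, reverse_natDegree_le R,
    natDegree_map_eq_of_injective (RingHom.injective _) M, fun t => ?_⟩
  have hE := expI_ne_zero t
  have hc : (starRingEnd ℂ) (expI t) = (expI t)⁻¹ := by
    rw [Complex.inv_def, Complex.normSq_eq_norm_sq, norm_expI]; simp
  have h1 : (starRingEnd ℂ) (M.eval (expI t)) = R.eval (expI t)⁻¹ := by
    rw [hR, ← hc, eval_map, eval₂_at_apply]
  let _ := invertibleOfNonzero (inv_ne_zero hE)
  have h2 := eval₂_reverse_mul_pow (RingHom.id ℂ) (expI t)⁻¹ R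
  rw [invOf_eq_inv, inv_inv, eval₂_id, eval₂_id] at h2
  rw [h1, ← h2, inv_pow, inv_mul_cancel_right₀ (pow_ne_zero _ hE)]

theorem IsTrigPoly.exists_polynomial {f : ℝ → ℝ} (hf : IsTrigPoly f) :
    ∃ (M : ℂ[X]) (n : ℕ), ∀ t, (f t : ℂ) * expI t ^ n = M.eval (expI t) := by
  have hI2 : Complex.I ^ 2 = -1 := Complex.I_sq
  have hcs : ∀ t : ℝ, (Real.cos t : ℂ) ^ 2 + (Real.sin t : ℂ) ^ 2 = 1 := fun t => by
    exact_mod_cast Real.cos_sq_add_sin_sq t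
  induction hf using Algebra.adjoin_induction with
  | mem x hx =>
    rcases hx with rfl | rfl
    · refine ⟨C (-Complex.I / 2) * (X ^ 2 - 1), 1, fun t => ?_⟩
      simp only [eval_mul, eval_C, eval_sub, eval_pow, eval_X, eval_one, pow_one, expI_eq]
      linear_combination (Real.cos t * Real.sin t + Real.sin t ^ 2 * Complex.I / 2) * hI2 +
        Complex.I / 2 * (hcs t)
    · refine ⟨C (1 / 2) * (X ^ 2 + 1), 1, fun t => ?_⟩
      simp only [eval_mul, eval_C, eval_add, eval_pow, eval_X, eval_one, pow_one, expI_eq]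
      linear_combination (-(Real.sin t : ℂ) ^ 2 / 2) * hI2 + 1 / 2 * (hcs t)
  | algebraMap r => exact ⟨C (r : ℂ), 0, fun t => by simp⟩
  | add f g _ _ hf hg =>
    obtain ⟨M, n, h1⟩ := hf
    obtain ⟨M', n', h2⟩ := hg
    refine ⟨M * X ^ n' + M' * X ^ n, n + n', fun t => ?_⟩
    simp only [eval_add, eval_mul, eval_pow, eval_X, ← h1, ← h2, Pi.add_apply, Complex.ofReal_add]
    ring
  | mul f g _ _ hf hg =>
    obtain ⟨M, n, h1⟩ := hf
    obtain ⟨M', n', h2⟩ := hg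
    refine ⟨M * M', n + n', fun t => ?_⟩
    simp only [eval_mul, ← h1, ← h2, Pi.mul_apply, Complex.ofReal_mul]
    ring

theorem isTrigPoly_const (c : ℝ) : IsTrigPoly fun _ => c :=
  Subalgebra.algebraMap_mem (Algebra.adjoin ℝ ({Real.sin, Real.cos} : Set (ℝ → ℝ))) c

theorem IsTrigPoly.add {f g : ℝ → ℝ} (hf : IsTrigPoly f) (hg : IsTrigPoly g) :
    IsTrigPoly fun t => f t + g t := Subalgebra.add_mem _ hf hg

theorem IsTrigPoly.sub {f g : ℝ → ℝ} (hf : IsTrigPoly f) (hg : IsTrigPoly g) :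
    IsTrigPoly fun t => f t - g t := Subalgebra.sub_mem _ hf hg

theorem IsTrigPoly.mul {f g : ℝ → ℝ} (hf : IsTrigPoly f) (hg : IsTrigPoly g) :
    IsTrigPoly fun t => f t * g t := Subalgebra.mul_mem _ hf hg

theorem IsTrigPoly.neg {f : ℝ → ℝ} (hf : IsTrigPoly f) : IsTrigPoly fun t => -f t :=
  Subalgebra.neg_mem _ hf

theorem isTrigPoly_sin : IsTrigPoly Real.sin := Algebra.subset_adjoin (by simp)

theorem isTrigPoly_cos : IsTrigPoly Real.cos := Algebra.subset_adjoin (by simp)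

/-- The functions `ℝ → ℂ` whose real and imaginary parts are trigonometric polynomials. -/
def IsComplexTrigPoly (f : ℝ → ℂ) : Prop :=
  (IsTrigPoly fun t => (f t).re) ∧ IsTrigPoly fun t => (f t).im

theorem isComplexTrigPoly_const (c : ℂ) : IsComplexTrigPoly fun _ => c :=
  ⟨isTrigPoly_const _, isTrigPoly_const _⟩

theorem IsComplexTrigPoly.add {f g : ℝ → ℂ} (hf : IsComplexTrigPoly f)
    (hg : IsComplexTrigPoly g) : IsComplexTrigPoly fun t => f t + g t := by
  refine ⟨?_, ?_⟩
  · simpa only [Complex.add_re] using hf.1.add hg.1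
  · simpa only [Complex.add_im] using hf.2.add hg.2

theorem IsComplexTrigPoly.mul {f g : ℝ → ℂ} (hf : IsComplexTrigPoly f)
    (hg : IsComplexTrigPoly g) : IsComplexTrigPoly fun t => f t * g t := by
  refine ⟨?_, ?_⟩
  · simpa only [Complex.mul_re] using (hf.1.mul hg.1).sub (hf.2.mul hg.2)
  · simpa only [Complex.mul_im] using (hf.1.mul hg.2).add (hf.2.mul hg.1)

theorem IsComplexTrigPoly.pow {f : ℝ → ℂ} (hf : IsComplexTrigPoly f) (n : ℕ) :
    IsComplexTrigPoly fun t => f t ^ n := by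
  induction n with
  | zero => simpa using isComplexTrigPoly_const 1
  | succ n ih => simpa only [pow_succ] using ih.mul hf

theorem isComplexTrigPoly_expI : IsComplexTrigPoly expI := by
  have h1 : ∀ t, (expI t).re = Real.cos t := Complex.exp_ofReal_mul_I_re
  have h2 : ∀ t, (expI t).im = Real.sin t := Complex.exp_ofReal_mul_I_im
  refine ⟨?_, ?_⟩
  · simpa only [h1] using isTrigPoly_cos
  · simpa only [h2] using isTrigPoly_sin

theorem isComplexTrigPoly_inv_expI : IsComplexTrigPoly fun t => (expI t)⁻¹ := by
  have hc : ∀ t, (expI t)⁻¹ = (starRingEnd ℂ) (expI t) := fun t => by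
    rw [Complex.inv_def, Complex.normSq_eq_norm_sq, norm_expI]; simp
  simp only [hc]
  refine ⟨?_, ?_⟩
  · simpa only [Complex.conj_re] using isComplexTrigPoly_expI.1
  · simpa only [Complex.conj_im] using isComplexTrigPoly_expI.2.neg

theorem isComplexTrigPoly_laurent (M : ℂ[X]) (n : ℕ) :
    IsComplexTrigPoly fun t => M.eval (expI t) / expI t ^ n := by
  have hM : IsComplexTrigPoly fun t => M.eval (expI t) := by
    induction M using Polynomial.induction_on' with
    | add p q hp hq => simpa only [eval_add] using hp.add hq
    | monomial k c =>
      simpa only [eval_monomial] using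
        (isComplexTrigPoly_const c).mul (isComplexTrigPoly_expI.pow k)
  simpa only [div_eq_mul_inv, inv_pow] using hM.mul (isComplexTrigPoly_inv_expI.pow n)

theorem hasDerivAt_laurent (M : ℂ[X]) (n : ℕ) (t : ℝ) :
    HasDerivAt (fun t => M.eval (expI t) / expI t ^ n)
      (Complex.I * (X * derivative M - C (n : ℂ) * M).eval (expI t) / expI t ^ n) t := by
  have hE := expI_ne_zero t
  have h1 : HasDerivAt (fun t => M.eval (expI t))
      ((derivative M).eval (expI t) * (Complex.I * expI t)) t :=
    (M.hasDerivAt (expI t)).comp t (hasDerivAt_expI t)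
  have h2 := (hasDerivAt_expI t).pow n
  have h3 := h1.div h2 (pow_ne_zero _ hE)
  refine h3.congr_deriv ?_
  simp only [Pi.pow_apply, eval_sub, eval_mul, eval_X, eval_C]
  rcases n with _ | n
  · simp [mul_left_comm, mul_comm (expI t)]
  · simp only [Nat.add_sub_cancel, Nat.cast_add, Nat.cast_one]
    field_simp
    ring

theorem HasDerivAt.complex_re {f : ℝ → ℂ} {f' : ℂ} {t : ℝ} (h : HasDerivAt f f' t) :
    HasDerivAt (fun t => (f t).re) f'.re t :=
  Complex.reCLM.hasFDerivAt.comp_hasDerivAt t h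

theorem IsTrigPoly.exists_hasDerivAt {a : ℝ → ℝ} (ha : IsTrigPoly a) :
    ∃ (A : ℝ → ℝ) (c : ℝ), IsTrigPoly A ∧ ∀ t, HasDerivAt A (a t - c) t := by
  obtain ⟨M, n, hM⟩ := ha.exists_polynomial
  have key : ∃ (M' : ℂ[X]) (c : ℂ), ∀ z, z ≠ 0 →
      Complex.I * (X * derivative M' - C (n : ℂ) * M').eval z = M.eval z - c * z ^ n := by
    clear hM
    induction M using Polynomial.induction_on' with
    | add p q hp hq =>
      obtain ⟨p', c, h1⟩ := hp
      obtain ⟨q', d, h2⟩ := hq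
      refine ⟨p' + q', c + d, fun z hz => ?_⟩
      have e1 := h1 z hz
      have e2 := h2 z hz
      simp only [eval_sub, eval_mul, eval_X, eval_C, eval_add, derivative_add] at e1 e2 ⊢
      linear_combination e1 + e2
    | monomial k c =>
      by_cases hkn : k = n
      · exact ⟨0, c, fun z hz => by simp [hkn]⟩
      · have hkn' : (k : ℂ) - n ≠ 0 := sub_ne_zero.2 (by exact_mod_cast hkn)
        refine ⟨monomial k (c / (Complex.I * (k - n))), 0, fun z hz => ?_⟩
        have hX : z * z ^ (k - 1) * k = z ^ k * k := by
          rcases k with _ | k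
          · simp
          · rw [Nat.add_sub_cancel, pow_succ]; ring
        simp only [derivative_monomial, eval_sub, eval_mul, eval_X, eval_monomial, eval_C]
        have hII := Complex.I_ne_zero
        field_simp
        linear_combination c * hX
  obtain ⟨M', c, hM'⟩ := key
  refine ⟨fun t => (M'.eval (expI t) / expI t ^ n).re, c.re, (isComplexTrigPoly_laurent M' n).1,
    fun t => ?_⟩
  refine (hasDerivAt_laurent M' n t).complex_re.congr_deriv ?_
  have hE := pow_ne_zero n (expI_ne_zero t)
  rw [hM' _ (expI_ne_zero t), ← hM, ← sub_mul, mul_div_cancel_right₀ _ hE]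
  simp

theorem IsTrigPoly.periodic {f : ℝ → ℝ} (hf : IsTrigPoly f) :
    Function.Periodic f (2 * Real.pi) := by
  induction hf using Algebra.adjoin_induction with
  | mem x hx =>
    rcases hx with rfl | rfl
    · exact Real.sin_periodic
    · exact Real.cos_periodic
  | algebraMap r => exact fun t => rfl
  | add f g _ _ hf hg => exact hf.add hg
  | mul f g _ _ hf hg => exact hf.mul hg

theorem IsTrigPoly.differentiable {f : ℝ → ℝ} (hf : IsTrigPoly f) : Differentiable ℝ f := by
  induction hf using Algebra.adjoin_induction with
  | mem x hx =>
    rcases hx with rfl | rfl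
    · exact Real.differentiable_sin
    · exact Real.differentiable_cos
  | algebraMap r => exact differentiable_const r
  | add f g _ _ hf hg => exact hf.add hg
  | mul f g _ _ hf hg => exact hf.mul hg

theorem exists_re_eval (p : ℂ[X]) : ∃ P : ℝ[X], ∀ x : ℝ, P.eval x = (p.eval (x : ℂ)).re := by
  induction p using Polynomial.induction_on' with
  | add p q hp hq =>
    obtain ⟨P, hP⟩ := hp
    obtain ⟨Q, hQ⟩ := hq
    exact ⟨P + Q, fun x => by simp [hP, hQ]⟩
  | monomial k c =>
    exact ⟨monomial k c.re, fun x => by simp [eval_monomial, ← Complex.ofReal_pow]⟩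

/-- A nonconstant real trigonometric polynomial has a pole at the origin as a function of
`exp (i t)`: otherwise, by conjugation, it would also be a polynomial in `exp (-i t)`. -/
theorem IsTrigPoly.exists_polynomial_eval_zero_ne {f : ℝ → ℝ} (hf : IsTrigPoly f)
    (hnc : ¬ ∃ c, ∀ t, f t = c) :
    ∃ (M : ℂ[X]) (n : ℕ), 0 < n ∧ M.eval 0 ≠ 0 ∧
      ∀ t, (f t : ℂ) * expI t ^ n = M.eval (expI t) := by
  classical
  have hex : ∃ n, ∃ M : ℂ[X], ∀ t, (f t : ℂ) * expI t ^ n = M.eval (expI t) := by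
    obtain ⟨M, n, h⟩ := hf.exists_polynomial
    exact ⟨n, M, h⟩
  obtain ⟨M, hM⟩ := Nat.find_spec hex
  have hmin := fun m => Nat.find_min hex (m := m)
  generalize Nat.find hex = n at hM hmin
  have hn : 0 < n := by
    rw [Nat.pos_iff_ne_zero]
    rintro rfl
    obtain ⟨M', d, hd, hdM, h⟩ := exists_conj_eval M
    have e : M * X ^ d = M' := polynomial_eq_of_eval_expI fun t => by
      rw [← h, ← hM]
      simp [← hM]
    have hM0 : M.natDegree = 0 := by
      by_cases hz : M = 0
      · simp [hz]
      · rw [← e, natDegree_mul_X_pow _ hz] at hd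
        omega
    refine hnc ⟨(M.coeff 0).re, fun t => ?_⟩
    have ht := hM t
    rw [eq_C_of_natDegree_eq_zero hM0, eval_C, pow_zero, mul_one] at ht
    rw [← ht, Complex.ofReal_re]
  refine ⟨M, n, hn, fun h0 => ?_, hM⟩
  obtain ⟨M', hM'⟩ := X_dvd_iff.2 ((coeff_zero_eq_eval_zero M).trans h0)
  refine hmin (n - 1) (Nat.sub_lt hn one_pos) ⟨M', fun t => ?_⟩
  have ht := hM t
  rw [hM', eval_mul, eval_X] at ht
  refine mul_left_cancel₀ (expI_ne_zero t) ?_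
  rw [← ht]
  rw [← mul_pow_sub_one hn.ne' (expI t)]
  ring

end Trig

/-! ### From identified pairs to a composition -/

section Composition

open Polynomial

variable {ι : Type*} {l : Filter ι}

/-- A polynomial is determined by its values at the values of a generator on the unit circle. -/
theorem IsLaurentGenerator.eq_of_eval_eq {u v : ι → ℂ} {N : ℂ[X]} {j : ℕ}
    (h : IsLaurentGenerator l u v N j) (hpow : ∀ k, 0 < k → ¬ ∀ᶠ i in l, u i ^ k = v i ^ k)
    {p q : ℂ[X]} (hpq : ∀ t, p.eval (N.eval (expI t) / expI t ^ j) =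
      q.eval (N.eval (expI t) / expI t ^ j)) : p = q := by
  rw [← sub_eq_zero]
  set s := p - q with hs
  have hzero : homogEval s N (X ^ j) s.natDegree = 0 := polynomial_eq_of_eval_expI fun t => by
    have hE := expI_ne_zero t
    rw [eval_homogEval N le_rfl (by simp [hE]), eval_pow, eval_X, hs, eval_sub, hpq, sub_self,
      mul_zero, eval_zero]
  refine Polynomial.funext fun y => ?_
  obtain ⟨z, hz0, hzy⟩ := exists_eval_eq_of_paired hpow h.pos h.eval_zero_ne h.paired y
  have e := congrArg (eval z) hzero
  have hzj := pow_ne_zero j hz0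
  rw [eval_homogEval N le_rfl (by simp [hz0]), eval_pow, eval_X, hzy,
    mul_div_cancel_right₀ _ hzj, eval_zero] at e
  rw [eval_zero]
  exact (mul_eq_zero.1 e).resolve_left (pow_ne_zero _ hzj)

/-- Along pairs of points of the unit circle, a generator can be chosen to be real on the circle:
the conjugate of a generator `r` is again identified along the pairs, hence a polynomial in `r`,
of degree one because conjugation is an involution. -/
theorem IsLaurentGenerator.exists_real {s t : ι → ℝ} {N : ℂ[X]} {j : ℕ}
    (h : IsLaurentGenerator l (fun i => expI (s i)) (fun i => expI (t i)) N j)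
    (hpow : ∀ k, 0 < k → ¬ ∀ᶠ i in l, expI (s i) ^ k = expI (t i) ^ k) :
    ∃ N' : ℂ[X], IsLaurentGenerator l (fun i => expI (s i)) (fun i => expI (t i)) N' j ∧
      ∀ x, (N'.eval (expI x) / expI x ^ j).im = 0 := by
  set ρ : ℝ → ℂ := fun x => N.eval (expI x) / expI x ^ j with hρ
  have hρs : ∀ᶠ i in l, ρ (s i) = ρ (t i) := by
    filter_upwards [h.paired] with i hi
    exact (div_eq_div_iff (pow_ne_zero _ (expI_ne_zero _)) (pow_ne_zero _ (expI_ne_zero _))).2 hi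
  obtain ⟨M, d, -, -, hM⟩ := exists_conj_eval N
  have hconj : ∀ x, (M * X ^ j).eval (expI x) = (starRingEnd ℂ) (ρ x) * expI x ^ d := fun x => by
    have hE := expI_ne_zero x
    have hc : (starRingEnd ℂ) (expI x) = (expI x)⁻¹ := by
      rw [Complex.inv_def, Complex.normSq_eq_norm_sq, norm_expI]; simp
    rw [eval_mul, ← hM, eval_pow, eval_X, hρ]
    simp only [map_div₀, map_pow, hc, inv_pow, div_inv_eq_mul]
    ring
  obtain ⟨p, hp⟩ := h.exists_eq_eval hpow (f := M * X ^ j) (m := d) (by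
    filter_upwards [hρs] with i hi
    rw [hconj, hconj, hi]
    ring)
  have hp' : ∀ x, (starRingEnd ℂ) (ρ x) = p.eval (ρ x) := fun x => by
    have e := hp _ (expI_ne_zero x)
    rw [hconj] at e
    exact mul_left_cancel₀ (pow_ne_zero d (expI_ne_zero x)) (by rw [← e]; ring)
  have hcomp : (p.map (starRingEnd ℂ)).comp p = X := h.eq_of_eval_eq hpow fun x => by
    rw [eval_comp, eval_X]
    change eval (eval (ρ x) p) _ = ρ x
    rw [← hp', eval_map, eval₂_at_apply, ← hp', Complex.conj_conj]
  have hdeg : p.natDegree = 1 := by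
    have e := congrArg natDegree hcomp
    rw [natDegree_comp, natDegree_X,
      natDegree_map_eq_of_injective (RingHom.injective (starRingEnd ℂ))] at e
    exact Nat.eq_one_of_mul_eq_one_left e
  obtain ⟨α, β, hαβ⟩ := exists_eq_X_add_C_of_natDegree_le_one hdeg.le
  have hρc : ∀ x, (starRingEnd ℂ) (ρ x) = α * ρ x + β := fun x => by
    rw [hp', hαβ]; simp
  -- a nonconstant one of the real and imaginary parts of `ρ`, which are affine functions of `ρ`
  obtain ⟨c, d', hc, hreal⟩ : ∃ c d' : ℂ, c ≠ 0 ∧ ∀ x, (c * ρ x + d').im = 0 := by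
    by_cases hα : 1 + α = 0
    · refine ⟨-Complex.I, Complex.I * β / 2, neg_ne_zero.2 Complex.I_ne_zero, fun x => ?_⟩
      rw [← Complex.conj_eq_iff_im]
      have h2 := congrArg (starRingEnd ℂ) (hρc x)
      simp only [map_add, map_mul, Complex.conj_conj] at h2
      have h3 : α = -1 := by linear_combination hα
      simp only [map_add, map_mul, map_neg, Complex.conj_I, map_div₀, map_ofNat]
      rw [h3] at h2
      simp only [map_neg, map_one] at h2
      have h4 := hρc x
      rw [h3] at h4
      linear_combination (Complex.I / 2) * h4 + Complex.I / 2 * h2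
    · refine ⟨(1 + α), β, hα, fun x => ?_⟩
      have : (1 + α) * ρ x + β = ρ x + (starRingEnd ℂ) (ρ x) := by rw [hρc]; ring
      rw [this]
      simp
  refine ⟨_, h.affine hc d', fun x => ?_⟩
  have hE := pow_ne_zero j (expI_ne_zero x)
  rw [← hreal x]
  congr 1
  simp only [eval_add, eval_mul, eval_C, eval_pow, eval_X, hρ]
  field_simp

/-- If `A` and `b / A'` take equal values at `s i` and `t i`, along pairs with `t i - s i → 0` which
eventually avoid every given point, then `A'` and `b` satisfy the composition condition. The
assumption `t i - s i → 0` keeps the powers `exp (i k t)` out of the field of identified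
functions. -/
theorem compositionCondition_of_identified [l.NeBot] {A a b : ℝ → ℝ} (hA : IsTrigPoly A)
    (hAa : ∀ t, HasDerivAt A (a t) t) (ha : ∃ t, a t ≠ 0) (ha_trig : IsTrigPoly a)
    (hb : IsTrigPoly b) {s t : ι → ℝ}
    (hs : Tendsto (fun i => expI (s i)) l cofinite) (ht : Tendsto (fun i => expI (t i)) l cofinite)
    (hst : ∀ᶠ i in l, s i < t i) (hlim : Tendsto (fun i => t i - s i) l (𝓝 0))
    (hAst : ∀ᶠ i in l, A (s i) = A (t i)) (hab : ∀ᶠ i in l, a (s i) * b (t i) = a (t i) * b (s i)) :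
    CompositionCondition a b := by
  have hpow : ∀ k, 0 < k → ¬ ∀ᶠ i in l, expI (s i) ^ k = expI (t i) ^ k := by
    intro k hk hev
    have hk' : (0 : ℝ) < k := by exact_mod_cast hk
    have hsmall : ∀ᶠ i in l, t i - s i < 2 * Real.pi / k :=
      hlim.eventually (gt_mem_nhds (by positivity))
    obtain ⟨i, h1, h2, h3⟩ := (hev.and (hst.and hsmall)).exists
    rw [expI, expI, ← Complex.exp_nat_mul, ← Complex.exp_nat_mul,
      Complex.exp_eq_exp_iff_exists_int] at h1
    obtain ⟨n, hn⟩ := h1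
    have e1 : ((k * s i : ℝ) : ℂ) = ((k * t i + n * (2 * Real.pi) : ℝ) : ℂ) := by
      refine mul_right_cancel₀ Complex.I_ne_zero ?_
      push_cast
      linear_combination hn
    have e2 : k * s i = k * t i + n * (2 * Real.pi) := by exact_mod_cast e1
    have hpi := Real.pi_pos
    rw [lt_div_iff₀ hk'] at h3
    have h4 : (n : ℝ) < 0 := by
      by_contra! hc
      nlinarith
    have h5 : (-1 : ℝ) < n := by
      by_contra! hc
      nlinarith
    have a1 : n < 0 := by exact_mod_cast h4
    have a2 : -1 < n := by exact_mod_cast h5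
    omega
  have hAnc : ¬ ∃ c, ∀ x, A x = c := by
    rintro ⟨c, hc⟩
    obtain ⟨x, hx⟩ := ha
    have : A = fun _ => c := funext hc
    have h1 := hAa x
    rw [this] at h1
    exact hx (h1.unique (hasDerivAt_const x c))
  obtain ⟨M, n, hn, hM0, hM⟩ := hA.exists_polynomial_eval_zero_ne hAnc
  have hMpair : ∀ᶠ i in l, M.eval (expI (s i)) * expI (t i) ^ n =
      M.eval (expI (t i)) * expI (s i) ^ n := by
    filter_upwards [hAst] with i hi
    rw [← hM, ← hM, hi]
    ring
  obtain ⟨N₀, j, hN₀⟩ := exists_isLaurentGenerator hs ht hn hM0 hMpair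
  obtain ⟨N, hN, hreal⟩ := hN₀.exists_real hpow
  set h : ℝ → ℝ := fun x => (N.eval (expI x) / expI x ^ j).re with hh
  have hh_trig : IsTrigPoly h := (isComplexTrigPoly_laurent N j).1
  have hhN : ∀ x, N.eval (expI x) / expI x ^ j = h x := fun x =>
    Complex.ext (by simp [hh]) (by simpa using hreal x)
  set W : ℂ[X] := X * derivative N - C (j : ℂ) * N with hW
  have hder : ∀ x, HasDerivAt h (Complex.I * W.eval (expI x) / expI x ^ j).re x := fun x =>
    (hasDerivAt_laurent N j x).complex_re
  have hderiv : ∀ x, HasDerivAt h (deriv h x) x := fun x => (hder x).differentiableAt.hasDerivAt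
  have hderW : ∀ x, Complex.I * W.eval (expI x) / expI x ^ j = deriv h x := fun x => by
    have e1 := hasDerivAt_laurent N j x
    have e2 : (fun t => N.eval (expI t) / expI t ^ j) = fun t => (h t : ℂ) := funext hhN
    rw [e2] at e1
    exact e1.unique (hderiv x).ofReal_comp
  obtain ⟨p, hp⟩ := hN.exists_eq_eval hpow hMpair
  obtain ⟨P, hP⟩ := exists_re_eval p
  have hAP : ∀ x, A x = P.eval (h x) := fun x => by
    have hE := pow_ne_zero n (expI_ne_zero x)
    have e := hp _ (expI_ne_zero x)
    rw [← hM, hhN, mul_comm] at e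
    rw [hP, ← mul_left_cancel₀ hE e, Complex.ofReal_re]
  have haP : ∀ x, a x = (derivative P).eval (h x) * deriv h x := fun x => by
    have e1 : HasDerivAt (fun x => P.eval (h x)) ((derivative P).eval (h x) * deriv h x) x :=
      (P.hasDerivAt (h x)).comp x (hderiv x)
    have e2 : A = fun x => P.eval (h x) := funext hAP
    exact (hAa x).unique (e2 ▸ e1)
  have ha0 : ∀ᶠ i in l, a (s i) ≠ 0 := by
    obtain ⟨Ma, na, hMa⟩ := ha_trig.exists_polynomial
    have hMa0 : Ma ≠ 0 := by
      rintro rfl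
      obtain ⟨x, hx⟩ := ha
      have e := hMa x
      rw [eval_zero, mul_eq_zero] at e
      exact hx (by exact_mod_cast e.resolve_right (pow_ne_zero _ (expI_ne_zero x)))
    filter_upwards [eventually_eval_ne_zero hs hMa0] with i hi h0
    rw [← hMa, h0] at hi
    simp at hi
  have hhst : ∀ᶠ i in l, h (s i) = h (t i) := by
    filter_upwards [hN.paired] with i hi
    have e := (div_eq_div_iff (pow_ne_zero j (expI_ne_zero (s i)))
      (pow_ne_zero j (expI_ne_zero (t i)))).2 hi
    rw [hhN, hhN] at e
    exact_mod_cast e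
  -- `b / h'` is identified along the pairs, since `b / a` and `a / h'` are
  have hbh : ∀ᶠ i in l, b (s i) * deriv h (t i) = b (t i) * deriv h (s i) := by
    filter_upwards [hab, ha0, hhst] with i h1 h2 h3
    rw [haP, haP (t i), ← h3] at h1
    rw [haP] at h2
    refine mul_left_cancel₀ (left_ne_zero_of_mul h2) ?_
    linear_combination -h1
  obtain ⟨Mb, nb, hMb⟩ := hb.exists_polynomial
  have hWx : ∀ x, W.eval (expI x) = -Complex.I * deriv h x * expI x ^ j := fun x => by
    rw [← hderW]
    have hE := pow_ne_zero j (expI_ne_zero x)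
    field_simp
    rw [Complex.I_sq]; ring
  obtain ⟨q, hq⟩ := hN.exists_eq_eval_mul_deriv hpow (f := Mb * X ^ j) (m := nb) (by
    filter_upwards [hbh] with i hi
    have hi' : (b (s i) : ℂ) * deriv h (t i) = b (t i) * deriv h (s i) := by exact_mod_cast hi
    rw [← hW]
    simp only [eval_mul, eval_pow, eval_X, ← hMb, hWx]
    linear_combination (expI (s i) ^ nb * expI (s i) ^ j * expI (t i) ^ nb * expI (t i) ^ j *
      -Complex.I) * hi')
  obtain ⟨Q, hQ⟩ := exists_re_eval (C (-Complex.I) * q)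
  refine ⟨derivative P, Q, h, hh_trig, fun x => ⟨haP x, ?_⟩⟩
  have e := hq _ (expI_ne_zero x)
  rw [← hW] at e
  rw [hhN, eval_mul (p := X ^ nb)] at e
  simp only [eval_mul, eval_pow, eval_X, ← hMb, hWx] at e
  have hE := pow_ne_zero j (expI_ne_zero x)
  have hE' := pow_ne_zero nb (expI_ne_zero x)
  have e' : (b x : ℂ) = (C (-Complex.I) * q).eval (h x : ℂ) * deriv h x := by
    rw [eval_mul, eval_C]
    refine mul_right_cancel₀ hE (mul_right_cancel₀ hE' ?_)
    linear_combination e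
  rw [hQ, ← Complex.re_mul_ofReal, ← e', Complex.ofReal_re]

end Composition

/-! ### The composition condition implies a global center -/

section Existence

theorem lipschitzWith_mul_abs_add (p q : ℝ) {C : NNReal} (hp : |p| ≤ C) :
    LipschitzWith C fun x : ℝ => p * |x| + q := by
  refine LipschitzWith.of_dist_le_mul fun x y => ?_
  rw [Real.dist_eq, Real.dist_eq, show p * |x| + q - (p * |y| + q) = p * (|x| - |y|) by ring,
    abs_mul]
  exact mul_le_mul hp (abs_abs_sub_abs_le x y) (abs_nonneg _) C.2

/-- A Grönwall bound on both sides of the initial time. -/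
theorem abs_le_gronwallBound_of_abs_deriv_le {X X' : ℝ → ℝ} {m M c C : ℝ} (hc : c ∈ Icc m M)
    (hC : 0 ≤ C) (hX : ∀ s ∈ Icc m M, HasDerivWithinAt X (X' s) (Icc m M) s)
    (hX' : ∀ s ∈ Icc m M, |X' s| ≤ C * |X s| + C) :
    ∀ s ∈ Icc m M, |X s| ≤ gronwallBound |X c| C C (M - m) := by
  have key : ∀ {Y Y' : ℝ → ℝ} {α β : ℝ}, (∀ s ∈ Icc α β, HasDerivWithinAt Y (Y' s) (Icc α β) s) →
      (∀ s ∈ Icc α β, |Y' s| ≤ C * |Y s| + C) →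
      ∀ s ∈ Icc α β, |Y s| ≤ gronwallBound |Y α| C C (s - α) := by
    intro Y Y' α β hY hY' s hs
    exact norm_le_gronwallBound_of_norm_deriv_right_le (f' := Y')
      (fun t ht => (hY t ht).continuousWithinAt)
      (fun t ht => (hY t (Ico_subset_Icc_self ht)).mono_of_mem_nhdsWithin
        (Icc_mem_nhdsGE_of_mem ht)) le_rfl (fun t ht => hY' t (Ico_subset_Icc_self ht)) s hs
  have hmono := gronwallBound_mono (abs_nonneg (X c)) hC hC
  intro s hs
  rcases le_total c s with hcs | hsc
  · have hsub : Icc c M ⊆ Icc m M := Icc_subset_Icc_left hc.1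
    refine (key (Y := X) (fun t ht => (hX t (hsub ht)).mono hsub) (fun t ht => hX' t (hsub ht)) s
      ⟨hcs, hs.2⟩).trans (hmono ?_)
    linarith [hc.1, hs.2]
  · have hmaps : MapsTo (fun t : ℝ => -t) (Icc (-c) (-m)) (Icc m M) := fun t ht =>
      ⟨by linarith [ht.2], by linarith [ht.1, hc.2]⟩
    have h := key (Y := fun t => X (-t)) (Y' := fun t => X' (-t) * -1) (α := -c) (β := -m)
      (fun t ht => (hX (-t) (hmaps ht)).comp t (hasDerivAt_neg t).hasDerivWithinAt hmaps)
      (fun t ht => by simpa using hX' (-t) (hmaps ht)) (-s) ⟨by linarith, by linarith [hs.1]⟩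
    simp only [neg_neg] at h
    refine h.trans (hmono ?_)
    linarith [hc.2, hs.1]

/-- Existence on a whole compact interval for an equation `X' = p(s)|X| + q(s)`. The
Picard-Lindelöf theorem applies to the bounded equation with `|X|` truncated at the level given
by the Grönwall bound, which its solution does not reach. -/
theorem exists_hasDerivWithinAt_Icc {p q : ℝ → ℝ} (hp : Continuous p) (hq : Continuous q)
    {m M c : ℝ} (hc : c ∈ Icc m M) (x₀ : ℝ) :
    ∃ X : ℝ → ℝ, X c = x₀ ∧
      ∀ s ∈ Icc m M, HasDerivWithinAt X (p s * |X s| + q s) (Icc m M) s := by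
  obtain ⟨C₁, hC₁⟩ := (isCompact_Icc (a := m) (b := M)).exists_bound_of_continuousOn hp.continuousOn
  obtain ⟨C₂, hC₂⟩ := (isCompact_Icc (a := m) (b := M)).exists_bound_of_continuousOn hq.continuousOn
  set C : NNReal := ⟨max 0 (max C₁ C₂), le_max_left _ _⟩ with hC
  have hpC : ∀ s ∈ Icc m M, |p s| ≤ C := fun s hs =>
    (hC₁ s hs).trans ((le_max_left _ _).trans (le_max_right _ _))
  have hqC : ∀ s ∈ Icc m M, |q s| ≤ C := fun s hs =>
    (hC₂ s hs).trans ((le_max_right _ _).trans (le_max_right _ _))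
  set R := gronwallBound |x₀| C C (M - m) with hR
  have hmM : 0 ≤ M - m := by linarith [hc.1, hc.2]
  have hR0 : 0 ≤ R := by
    have h := gronwallBound_mono (abs_nonneg x₀) C.2 C.2 hmM
    rw [gronwallBound_x0] at h
    exact (abs_nonneg x₀).trans h
  set f : ℝ → ℝ → ℝ := fun s x => p s * min |x| R + q s with hf
  set L : NNReal := C * ⟨R, hR0⟩ + C with hL
  have hpl : IsPicardLindelof f (tmin := m) (tmax := M) ⟨c, hc⟩ x₀ (L * ⟨M - m, hmM⟩) 0 L C := by
    refine ⟨fun s hs => LipschitzWith.lipschitzOnWith (LipschitzWith.of_dist_le_mul fun x y => ?_),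
      fun x _ => by fun_prop, fun s hs x _ => ?_, ?_⟩
    · rw [Real.dist_eq, Real.dist_eq, show f s x - f s y = p s * (min |x| R - min |y| R) by
        simp only [hf]; ring, abs_mul]
      refine mul_le_mul (hpC s hs) ?_ (abs_nonneg _) C.2
      refine (abs_min_sub_min_le_max _ _ _ _).trans (max_le (abs_abs_sub_abs_le x y) ?_)
      simp
    · have h1 : |min |x| R| ≤ R := by
        rw [abs_of_nonneg (le_min (abs_nonneg x) hR0)]
        exact min_le_right _ _
      calc ‖f s x‖ ≤ |p s * min |x| R| + |q s| := abs_add_le _ _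
        _ ≤ C * R + C := by
          rw [abs_mul]
          exact add_le_add (mul_le_mul (hpC s hs) h1 (abs_nonneg _) C.2) (hqC s hs)
    · rw [NNReal.coe_zero, sub_zero]
      refine mul_le_mul_of_nonneg_left (max_le ?_ ?_) L.2
      · show M - c ≤ M - m
        linarith [hc.1]
      · show c - m ≤ M - m
        linarith [hc.2]
  obtain ⟨X, hXc, hX⟩ := hpl.exists_eq_forall_mem_Icc_hasDerivWithinAt₀
  refine ⟨X, hXc, fun s hs => ?_⟩
  have hb := abs_le_gronwallBound_of_abs_deriv_le hc C.2 hX fun s hs => by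
    have h1 : |min |X s| R| ≤ |X s| := by
      rw [abs_of_nonneg (le_min (abs_nonneg _) hR0)]
      exact min_le_left _ _
    refine (abs_add_le _ _).trans (add_le_add ?_ (hqC s hs))
    rw [abs_mul]
    exact mul_le_mul (hpC s hs) h1 (abs_nonneg _) C.2
  have h := hX s hs
  have hXc' : X c = x₀ := hXc
  rw [hXc'] at hb
  have hmin : min |X s| R = |X s| := min_eq_left (hb s hs)
  simp only [hf, hmin] at h
  exact h

/-- If `a = P(h) h'` and `b = Q(h) h'`, every solution of `x' = a|x| + b` is `X ∘ h` for a solution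
`X` of `X' = P|X| + Q`, and is therefore periodic like `h`. -/
theorem CompositionCondition.hasGlobalCenter {a b : ℝ → ℝ} (ha : IsTrigPoly a)
    (h : CompositionCondition a b) : HasGlobalCenter a b := by
  obtain ⟨P, Q, h, hh, hab⟩ := h
  intro φ hφ
  obtain ⟨B, hB⟩ : ∃ B, ∀ t, |h t| ≤ B := by
    obtain ⟨B, hB⟩ := (isCompact_Icc (a := 0) (b := 2 * Real.pi)).exists_bound_of_continuousOn
      hh.differentiable.continuous.continuousOn
    refine ⟨B, fun t => ?_⟩
    obtain ⟨y, hy, hty⟩ := hh.periodic.exists_mem_Ico₀ (by positivity) t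
    rw [hty]
    exact hB y (Ico_subset_Icc_self hy)
  have hmem : ∀ t, h t ∈ Ioo (-(B + 1)) (B + 1) := fun t => by
    have := abs_le.1 (hB t)
    exact ⟨by linarith, by linarith⟩
  obtain ⟨X, hX0, hX⟩ := exists_hasDerivWithinAt_Icc P.continuous Q.continuous
    (Ioo_subset_Icc_self (hmem 0)) (φ 0)
  have hψ : ∀ t, HasDerivAt (fun t => X (h t)) (a t * |X (h t)| + b t) t := fun t => by
    have h1 := (hX _ (Ioo_subset_Icc_self (hmem t))).hasDerivAt
      (Icc_mem_nhds (hmem t).1 (hmem t).2)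
    refine (h1.comp t (hh.differentiable t).hasDerivAt).congr_deriv ?_
    rw [(hab t).1, (hab t).2]
    ring
  obtain ⟨C, hC⟩ := (isCompact_Icc (a := 0) (b := 2 * Real.pi)).exists_bound_of_continuousOn
    ha.differentiable.continuous.continuousOn
  have hEq : EqOn φ (fun t => X (h t)) (Icc 0 (2 * Real.pi)) :=
    ODE_solution_unique_of_mem_Icc_right (v := fun t x => a t * |x| + b t) (s := fun _ => univ)
      (K := ⟨max 0 C, le_max_left _ _⟩)
      (fun t ht => (lipschitzWith_mul_abs_add (a t) (b t)
        ((hC t (Ico_subset_Icc_self ht)).trans (le_max_right _ _))).lipschitzOnWith)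
      (fun t _ => (hφ t).continuousAt.continuousWithinAt) (fun t _ => (hφ t).hasDerivWithinAt)
      (fun _ _ => mem_univ _)
      (fun t _ => (hψ t).continuousAt.continuousWithinAt) (fun t _ => (hψ t).hasDerivWithinAt)
      (fun _ _ => mem_univ _) hX0.symm
  have hper : h (2 * Real.pi) = h 0 := by simpa using hh.periodic 0
  rw [hEq ⟨by positivity, le_rfl⟩]
  change φ 0 = X (h (2 * Real.pi))
  rw [hper, hX0]

end Existence

/-! ### Solutions with two zeros -/

section Crossing

theorem pos_of_ordConnected {φ : ℝ → ℝ} (hφ : Continuous φ) {J : Set ℝ} (hJ : J.OrdConnected)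
    (h0 : ∀ r ∈ J, φ r ≠ 0) {r₀ : ℝ} (hr₀ : r₀ ∈ J) (hpos : 0 < φ r₀) : ∀ r ∈ J, 0 < φ r := by
  intro r hr
  by_contra! hle
  obtain ⟨y, hy, hy0⟩ := hJ.isPreconnected.intermediate_value hr hr₀ hφ.continuousOn
    ⟨hle, hpos.le⟩
  exact h0 y hy hy0

/-- Variation of constants on an interval where `x' = a|x| + b` is linear. -/
theorem sub_eq_of_linear {a b φ A G : ℝ → ℝ} {ε α β : ℝ} (hφ : IsSolution a b φ)
    (hA : ∀ t, HasDerivAt A (a t) t)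
    (hG : ∀ t, HasDerivAt G (b t * Real.exp (-(ε * A t))) t)
    (hlin : ∀ t ∈ Icc α β, |φ t| = ε * φ t) :
    ∀ t ∈ Icc α β, φ t * Real.exp (-(ε * A t)) - G t = φ α * Real.exp (-(ε * A α)) - G α := by
  have hd : ∀ t, HasDerivAt (fun t => φ t * Real.exp (-(ε * A t)) - G t)
      ((a t * |φ t| + b t) * Real.exp (-(ε * A t)) +
        φ t * (Real.exp (-(ε * A t)) * -(ε * a t)) - b t * Real.exp (-(ε * A t))) t := fun t =>
    ((hφ t).mul ((hA t).const_mul ε).neg.exp).sub (hG t)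
  refine constant_of_has_deriv_right_zero
    (fun t _ => (hd t).continuousAt.continuousWithinAt) fun t ht => ?_
  refine (hd t).hasDerivWithinAt.congr_deriv ?_
  rw [hlin t (Ico_subset_Icc_self ht)]
  ring

variable {a b φ A F G : ℝ → ℝ} {x s t : ℝ}

/-- A solution with a positive initial value and exactly two zeros, both simple, is positive, then
negative, then positive; the explicit solutions of the two linear equations describe its zeros. -/
theorem IsSolution.crossing (hφ : IsSolution a b φ)
    (hA : ∀ t, HasDerivAt A (a t) t) (hA0 : A 0 = 0)
    (hF : ∀ t, HasDerivAt F (b t * Real.exp (A t)) t)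
    (hG : ∀ t, HasDerivAt G (b t * Real.exp (-A t)) t) (hG0 : G 0 = 0)
    (hx : 0 < x) (hφ0 : φ 0 = x) (hφ2 : φ (2 * Real.pi) = x)
    (hz : HasExactlyTwoSimpleZeros φ s t) :
    (s ∈ Ioo 0 (2 * Real.pi) ∧ t ∈ Ioo 0 (2 * Real.pi) ∧ s < t) ∧ (b s ≠ 0 ∧ b t ≠ 0) ∧
    (G s = -x ∧ ∀ r ∈ Ico 0 s, -x < G r) ∧ F t = F s ∧
    (G t = G (2 * Real.pi) - x * Real.exp (-A (2 * Real.pi)) ∧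
      ∀ r ∈ Ioc t (2 * Real.pi), G (2 * Real.pi) - x * Real.exp (-A (2 * Real.pi)) < G r) := by
  obtain ⟨hst, hset, hds, hdt⟩ := hz
  have hcont : Continuous φ := continuous_iff_continuousAt.2 fun r => (hφ r).continuousAt
  have hs : s ∈ {r ∈ Ioo 0 (2 * Real.pi) | φ r = 0} := hset ▸ mem_insert _ _
  have ht : t ∈ {r ∈ Ioo 0 (2 * Real.pi) | φ r = 0} :=
    hset ▸ mem_insert_of_mem _ (mem_singleton _)
  obtain ⟨hsI, hs0⟩ := hs
  obtain ⟨htI, ht0⟩ := ht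
  have hnz : ∀ r ∈ Icc 0 (2 * Real.pi), r ≠ s → r ≠ t → φ r ≠ 0 := by
    intro r hr hrs hrt h0
    rcases eq_or_lt_of_le hr.1 with rfl | hr1
    · exact hx.ne' (hφ0 ▸ h0)
    rcases eq_or_lt_of_le hr.2 with rfl | hr2
    · exact hx.ne' (hφ2 ▸ h0)
    have : r ∈ ({s, t} : Set ℝ) := hset ▸ ⟨⟨hr1, hr2⟩, h0⟩
    rcases this with h | h
    · exact hrs h
    · exact hrt h
  have hbd : ∀ r, φ r = 0 → deriv φ r = b r := fun r hr => by
    rw [(hφ r).deriv, hr, abs_zero, mul_zero, zero_add]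
  have hpos1 : ∀ r ∈ Ico 0 s, 0 < φ r := by
    refine pos_of_ordConnected hcont ordConnected_Ico (fun r hr => ?_) (r₀ := 0)
      ⟨le_rfl, hsI.1⟩ (hφ0 ▸ hx)
    exact hnz r ⟨hr.1, by linarith [hr.2, hsI.2]⟩ hr.2.ne (hr.2.trans hst).ne
  have hpos3 : ∀ r ∈ Ioc t (2 * Real.pi), 0 < φ r := by
    refine pos_of_ordConnected hcont ordConnected_Ioc (fun r hr => ?_) (r₀ := 2 * Real.pi)
      ⟨htI.2, le_rfl⟩ (hφ2 ▸ hx)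
    exact hnz r ⟨by linarith [hr.1, htI.1], hr.2⟩ (hst.trans hr.1).ne' hr.1.ne'
  -- a solution positive on both sides of `s` would have a minimum there
  have hneg2 : ∀ r ∈ Icc s t, φ r ≤ 0 := by
    intro r hr
    by_contra! hr0
    have hr' : r ∈ Ioo s t := by
      refine ⟨lt_of_le_of_ne hr.1 ?_, lt_of_le_of_ne hr.2 ?_⟩
      · rintro rfl; exact hr0.ne' hs0
      · rintro rfl; exact hr0.ne' ht0
    have hp := pos_of_ordConnected hcont ordConnected_Ioo (fun y hy =>
      hnz y ⟨by linarith [hy.1, hsI.1], by linarith [hy.2, htI.2]⟩ hy.1.ne' hy.2.ne) hr' hr0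
    have hmin : IsLocalMin φ s := by
      filter_upwards [Ioo_mem_nhds hsI.1 hst] with y hy
      rw [hs0]
      rcases lt_trichotomy y s with h | h | h
      · exact (hpos1 y ⟨hy.1.le, h⟩).le
      · rw [h, hs0]
      · exact (hp y ⟨h, hy.2⟩).le
    exact hds hmin.deriv_eq_zero
  have hG' : ∀ t, HasDerivAt G (b t * Real.exp (-(1 * A t))) t := fun t => by
    simpa only [one_mul] using hG t
  have hF' : ∀ t, HasDerivAt F (b t * Real.exp (-(-1 * A t))) t := fun t => by
    simpa only [neg_mul, one_mul, neg_neg] using hF t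
  have e1 := sub_eq_of_linear (α := 0) (β := s) hφ hA hG' fun r hr => by
    rcases eq_or_lt_of_le hr.2 with rfl | h
    · simp [hs0]
    · rw [one_mul, abs_of_pos (hpos1 r ⟨hr.1, h⟩)]
  have e2 := sub_eq_of_linear (α := s) (β := t) hφ hA hF' fun r hr => by
    rw [neg_one_mul, abs_of_nonpos (hneg2 r hr)]
  have e3 := sub_eq_of_linear (α := t) (β := 2 * Real.pi) hφ hA hG' fun r hr => by
    rcases eq_or_lt_of_le hr.1 with rfl | h
    · simp [ht0]
    · rw [one_mul, abs_of_pos (hpos3 r ⟨h, hr.2⟩)]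
  simp only [one_mul, hφ0, hA0, hG0, neg_zero, Real.exp_zero, mul_one, sub_zero] at e1
  simp only [one_mul, ht0, zero_mul, zero_sub] at e3
  have e2' := e2 t ⟨hst.le, le_rfl⟩
  have e1' := e1 s ⟨hsI.1.le, le_rfl⟩
  have e3' := e3 (2 * Real.pi) ⟨htI.2.le, le_rfl⟩
  rw [hs0] at e1'
  rw [hs0, ht0] at e2'
  rw [hφ2] at e3'
  refine ⟨⟨hsI, htI, hst⟩, ⟨hbd s hs0 ▸ hds, hbd t ht0 ▸ hdt⟩, ⟨by linarith, fun r hr => ?_⟩,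
    by linarith, by linarith, fun r hr => ?_⟩
  · have h := e1 r ⟨hr.1, hr.2.le⟩
    have := mul_pos (hpos1 r hr) (Real.exp_pos (-A r))
    linarith
  · have h := e3 r ⟨hr.1.le, hr.2⟩
    have := mul_pos (hpos3 r hr) (Real.exp_pos (-A r))
    linarith

end Crossing

/-! ### Merging zeros give identified pairs -/

section Merging

/-- There are pairs of times `s < t`, indexed along a filter, with `t - s → 0`, never staying at a
given point of the circle, such that `∫ a` vanishes from `s` to `t` and `b / a` has the same value at
`s` and `t`; the latter is written without division. -/
def HasIdentifiedPairs (a b : ℝ → ℝ) : Prop :=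
  ∃ (l : Filter ℝ) (s t : ℝ → ℝ), l.NeBot ∧ Tendsto (fun i => expI (s i)) l cofinite ∧
    Tendsto (fun i => expI (t i)) l cofinite ∧ (∀ᶠ i in l, s i < t i) ∧
    Tendsto (fun i => t i - s i) l (𝓝 0) ∧ (∀ᶠ i in l, ∫ r in s i..t i, a r = 0) ∧
    ∀ᶠ i in l, a (s i) * b (t i) = a (t i) * b (s i)

theorem tendsto_sub_zero_of_hasDerivAt {l : Filter ℝ} {f f' : ℝ → ℝ}
    (hf : ∀ t, HasDerivAt f (f' t) t) (hf' : Continuous f') {α β : ℝ} {s t : ℝ → ℝ}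
    (hs : ∀ᶠ i in l, s i ∈ Icc α β) (ht : ∀ᶠ i in l, t i ∈ Icc α β)
    (hst : Tendsto (fun i => t i - s i) l (𝓝 0)) :
    Tendsto (fun i => f (t i) - f (s i)) l (𝓝 0) := by
  obtain ⟨C, hC⟩ := (isCompact_Icc (a := α) (b := β)).exists_bound_of_continuousOn hf'.continuousOn
  have h0 : Tendsto (fun i => C * ‖t i - s i‖) l (𝓝 0) := by
    simpa using hst.norm.const_mul C
  refine squeeze_zero_norm' ?_ h0
  filter_upwards [hs, ht] with i hsi hti
  exact (convex_Icc α β).norm_image_sub_le_of_norm_hasDerivWithin_le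
    (fun r _ => (hf r).hasDerivWithinAt) hC hsi hti

theorem tendsto_cofinite_of_injOn {α β : Type*} {l : Filter α} {f : α → β} {I : Set α}
    (hf : InjOn f I) (hI : I ∈ l) (hl : l ≤ cofinite) : Tendsto f l cofinite := by
  refine le_cofinite_iff_eventually_ne.2 fun w => ?_
  have hfin : {x ∈ I | f x = w}.Finite :=
    Set.Subsingleton.finite fun x hx y hy => hf hx.1 hy.1 (hx.2.trans hy.2.symm)
  rw [eventually_map]
  filter_upwards [hI, hl hfin.compl_mem_cofinite] with x hx hx' hw
  exact hx' ⟨hx, hw⟩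

theorem uniqueDiffWithinAt_inter_compl_of_countable {U Z : Set ℝ} (hU : IsOpen U)
    (hZ : Z.Countable) {x : ℝ} (hx : x ∈ U) : UniqueDiffWithinAt ℝ (U ∩ Zᶜ) x := by
  have h := ((hZ.union (countable_singleton x)).dense_compl ℝ).open_subset_closure_inter hU hx
  rw [mem_closure_iff_nhdsWithin_neBot, compl_union, ← inter_assoc] at h
  exact uniqueDiffWithinAt_iff_accPt.2 (accPt_principal_iff_nhdsWithin.2 h)

/-- The identified pairs are the zeros `t₁ x < t₂ x` of the solutions with initial value `x`.
With `A = ∫ a`, the explicit solutions show that the primitives `F` of `b exp A` and, up to a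
constant and a factor, `G` of `b exp (-A)` agree at `t₁ x` and `t₂ x`, while `G (t₁ x) = -x` makes
`t₁` and `t₂` monotone. Differentiation in `x` gives `A (t₁ x) = A (t₂ x)`, the constants being
determined by the merging of the zeros, and a second differentiation gives the equality of the
values of `b / a`. -/
theorem hasIdentifiedPairs_of_nonneg {a b : ℝ → ℝ} (ha : Continuous a) (hb : Continuous b)
    (hcenter : HasGlobalCenter a b) {x₁ x₂ : ℝ} (hx : x₁ < x₂) (hx₁ : 0 ≤ x₁) {t₁ t₂ : ℝ → ℝ}
    (hsol : ∀ x ∈ Ioo x₁ x₂, ∃ φ : ℝ → ℝ, IsSolution a b φ ∧ φ 0 = x ∧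
      HasExactlyTwoSimpleZeros φ (t₁ x) (t₂ x))
    (hlim : Tendsto (fun x => t₂ x - t₁ x) (𝓝[>] x₁) (𝓝 0) ∨
      Tendsto (fun x => t₂ x - t₁ x) (𝓝[<] x₂) (𝓝 0)) :
    (∫ r in 0..2 * Real.pi, a r = 0) ∧ ((∀ r, a r = 0) → ∫ r in 0..2 * Real.pi, b r = 0) ∧
      HasIdentifiedPairs a b := by
  set A : ℝ → ℝ := fun t => ∫ r in 0..t, a r with hAdef
  have hA : ∀ t, HasDerivAt A (a t) t := fun t => ha.integral_hasStrictDerivAt 0 t |>.hasDerivAt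
  have hA0 : A 0 = 0 := intervalIntegral.integral_same
  have hAc : Continuous A := continuous_iff_continuousAt.2 fun t => (hA t).continuousAt
  set F : ℝ → ℝ := fun t => ∫ r in 0..t, b r * Real.exp (A r) with hFdef
  have hF : ∀ t, HasDerivAt F (b t * Real.exp (A t)) t := fun t =>
    (Continuous.integral_hasStrictDerivAt (by fun_prop) 0 t).hasDerivAt
  set G : ℝ → ℝ := fun t => ∫ r in 0..t, b r * Real.exp (-A r) with hGdef
  have hG : ∀ t, HasDerivAt G (b t * Real.exp (-A t)) t := fun t =>
    (Continuous.integral_hasStrictDerivAt (f := fun t => b t * Real.exp (-A t))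
      (by fun_prop) 0 t).hasDerivAt
  have hG0 : G 0 = 0 := intervalIntegral.integral_same
  set α := Real.exp (-A (2 * Real.pi)) with hα
  have hα0 : 0 < α := Real.exp_pos _
  set γ := G (2 * Real.pi) with hγ
  set I := Ioo x₁ x₂ with hI
  have hcr : ∀ x ∈ I, (t₁ x ∈ Ioo 0 (2 * Real.pi) ∧ t₂ x ∈ Ioo 0 (2 * Real.pi) ∧ t₁ x < t₂ x) ∧
      (b (t₁ x) ≠ 0 ∧ b (t₂ x) ≠ 0) ∧ (G (t₁ x) = -x ∧ ∀ r ∈ Ico 0 (t₁ x), -x < G r) ∧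
      F (t₂ x) = F (t₁ x) ∧
      (G (t₂ x) = γ - x * α ∧ ∀ r ∈ Ioc (t₂ x) (2 * Real.pi), γ - x * α < G r) := by
    intro x hx
    obtain ⟨φ, hφ, hφ0, hz⟩ := hsol x hx
    exact hφ.crossing hA hA0 hF hG hG0 (hx₁.trans_lt hx.1) hφ0 ((hcenter φ hφ).symm.trans hφ0) hz
  have hmono₁ : MonotoneOn t₁ I := by
    intro x hx y hy hxy
    by_contra! hlt
    have h := (hcr x hx).2.2.1.2 (t₁ y) ⟨(hcr y hy).1.1.1.le, hlt⟩
    rw [(hcr y hy).2.2.1.1] at h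
    linarith
  have hanti₂ : AntitoneOn t₂ I := by
    intro x hx y hy hxy
    by_contra! hlt
    have h := (hcr x hx).2.2.2.2.2 (t₂ y) ⟨hlt, (hcr y hy).1.2.1.2.le⟩
    rw [(hcr y hy).2.2.2.2.1] at h
    nlinarith
  -- both zeros depend continuously on the initial value outside a countable set
  set Z : Set ℝ := {x | x ∈ I ∧ ¬ContinuousWithinAt t₁ I x} ∪
    {x | x ∈ I ∧ ¬ContinuousWithinAt t₂ I x} with hZ
  have hZc : Z.Countable :=
    hmono₁.countable_not_continuousWithinAt.union hanti₂.countable_not_continuousWithinAt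
  have hcont : ∀ x ∈ I, x ∉ Z → ContinuousAt t₁ x ∧ ContinuousAt t₂ x := by
    intro x hx hxZ
    have hIx : I ∈ 𝓝 x := Ioo_mem_nhds hx.1 hx.2
    constructor
    · by_contra hc
      exact hxZ (Or.inl ⟨hx, fun h => hc (h.continuousAt hIx)⟩)
    · by_contra hc
      exact hxZ (Or.inr ⟨hx, fun h => hc (h.continuousAt hIx)⟩)
  have hder₁ : ∀ x ∈ I, x ∉ Z →
      HasDerivAt t₁ (-(b (t₁ x) * Real.exp (-A (t₁ x))))⁻¹ x := by
    intro x hx hxZ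
    refine HasDerivAt.of_local_left_inverse (f := fun t => -G t) (hcont x hx hxZ).1 (hG _).neg
      (neg_ne_zero.2 (mul_ne_zero (hcr x hx).2.1.1 (Real.exp_ne_zero _))) ?_
    filter_upwards [Ioo_mem_nhds hx.1 hx.2] with y hy
    rw [(hcr y hy).2.2.1.1, neg_neg]
  have hder₂ : ∀ x ∈ I, x ∉ Z →
      HasDerivAt t₂ (-(b (t₂ x) * Real.exp (-A (t₂ x))) / α)⁻¹ x := by
    intro x hx hxZ
    refine HasDerivAt.of_local_left_inverse (f := fun t => (γ - G t) / α) (hcont x hx hxZ).2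
      (((hG _).const_sub γ).div_const α) (div_ne_zero
      (neg_ne_zero.2 (mul_ne_zero (hcr x hx).2.1.2 (Real.exp_ne_zero _))) hα0.ne') ?_
    filter_upwards [Ioo_mem_nhds hx.1 hx.2] with y hy
    rw [(hcr y hy).2.2.2.2.1]
    field_simp
    ring
  -- comparison of the derivatives in `F (t₁ x) = F (t₂ x)`
  have hAA : ∀ x ∈ I, x ∉ Z → 2 * A (t₁ x) = 2 * A (t₂ x) - A (2 * Real.pi) := by
    intro x hx hxZ
    have d₁ := (hF (t₁ x)).comp x (hder₁ x hx hxZ)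
    have d₂ := (hF (t₂ x)).comp x (hder₂ x hx hxZ)
    have heq : F ∘ t₂ =ᶠ[𝓝 x] F ∘ t₁ := by
      filter_upwards [Ioo_mem_nhds hx.1 hx.2] with y hy
      exact (hcr y hy).2.2.2.1
    have h := d₁.unique (d₂.congr_of_eventuallyEq heq.symm)
    obtain ⟨hb1, hb2⟩ := (hcr x hx).2.1
    have key : ∀ c E : ℝ, c ≠ 0 → c * Real.exp E * (-(c * Real.exp (-E)))⁻¹ =
        -Real.exp (2 * E) := fun c E hc => by
      rw [Real.exp_neg, two_mul, Real.exp_add]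
      have := Real.exp_ne_zero E
      field_simp
    have hinv : (-(b (t₂ x) * Real.exp (-A (t₂ x))) / α)⁻¹ =
        (-(b (t₂ x) * Real.exp (-A (t₂ x))))⁻¹ * α := by
      rw [inv_div, div_eq_mul_inv, mul_comm]
    rw [key _ _ hb1, hinv, ← mul_assoc, key _ _ hb2, neg_mul, neg_inj, hα, ← Real.exp_add] at h
    linarith [Real.exp_injective h]
  -- the filter at the end of the interval where the zeros merge
  obtain ⟨l₀, U, y₀, hl₀, hU, hy₀, hl₀I, hl₀c, hlim₀⟩ : ∃ (l₀ : Filter ℝ) (U : Set ℝ) (y₀ : ℝ),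
      l₀ = 𝓝[U] y₀ ∧ IsOpen U ∧ y₀ ∈ closure U ∧ I ∈ l₀ ∧ l₀ ≤ cofinite ∧
      Tendsto (fun x => t₂ x - t₁ x) l₀ (𝓝 0) := by
    rcases hlim with h | h
    · exact ⟨_, Ioi x₁, x₁, rfl, isOpen_Ioi, by simp [closure_Ioi], Ioo_mem_nhdsGT hx,
        (nhdsGT_le_nhdsNE x₁).trans (nhdsNE_le_cofinite x₁), h⟩
    · exact ⟨_, Iio x₂, x₂, rfl, isOpen_Iio, by simp [closure_Iio], Ioo_mem_nhdsLT hx,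
        (nhdsLT_le_nhdsNE x₂).trans (nhdsNE_le_cofinite x₂), h⟩
  have hdense : ∀ {V : Set ℝ}, IsOpen V → closure V ⊆ closure (V ∩ Zᶜ) := fun {V} hV =>
    closure_minimal ((hZc.dense_compl ℝ).open_subset_closure_inter hV) isClosed_closure
  set l := l₀ ⊓ 𝓟 Zᶜ with hl
  have hne : l.NeBot := by
    rw [hl, hl₀, nhdsWithin, inf_assoc, inf_principal, ← nhdsWithin]
    exact mem_closure_iff_nhdsWithin_neBot.1 (hdense hU hy₀)
  have hlI : ∀ᶠ x in l, x ∈ I := mem_inf_of_left hl₀I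
  have hlZ : ∀ᶠ x in l, x ∉ Z := mem_inf_of_right (mem_principal_self _)
  have hlc : l ≤ cofinite := inf_le_left.trans hl₀c
  have hlim' : Tendsto (fun x => t₂ x - t₁ x) l (𝓝 0) := hlim₀.mono_left inf_le_left
  have hmem₁ : ∀ᶠ x in l, t₁ x ∈ Icc 0 (2 * Real.pi) := by
    filter_upwards [hlI] with x hx
    exact Ioo_subset_Icc_self (hcr x hx).1.1
  have hmem₂ : ∀ᶠ x in l, t₂ x ∈ Icc 0 (2 * Real.pi) := by
    filter_upwards [hlI] with x hx
    exact Ioo_subset_Icc_self (hcr x hx).1.2.1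
  have hA2 : A (2 * Real.pi) = 0 := by
    have h1 := (tendsto_sub_zero_of_hasDerivAt hA ha hmem₁ hmem₂ hlim').const_mul 2
    rw [mul_zero] at h1
    refine tendsto_nhds_unique (tendsto_const_nhds.congr' ?_) h1
    filter_upwards [hlI, hlZ] with x hx hxZ
    linarith [hAA x hx hxZ]
  have hα1 : α = 1 := by rw [hα, hA2, neg_zero, Real.exp_zero]
  have hγ0 : γ = 0 := by
    have h1 := tendsto_sub_zero_of_hasDerivAt hG (by fun_prop) hmem₁ hmem₂ hlim'
    refine tendsto_nhds_unique (tendsto_const_nhds.congr' ?_) h1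
    filter_upwards [hlI] with x hx
    rw [(hcr x hx).2.2.1.1, (hcr x hx).2.2.2.2.1, hα1]
    ring
  have hAeq : ∀ x ∈ I, x ∉ Z → A (t₁ x) = A (t₂ x) := fun x hx hxZ => by
    linarith [hAA x hx hxZ]
  -- comparison of the derivatives in `A (t₁ x) = A (t₂ x)`
  have hab : ∀ x ∈ I, x ∉ Z → a (t₁ x) * b (t₂ x) = a (t₂ x) * b (t₁ x) := by
    intro x hx hxZ
    have d₁ := ((hA (t₁ x)).comp x (hder₁ x hx hxZ)).hasDerivWithinAt (s := I ∩ Zᶜ)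
    have d₂ := ((hA (t₂ x)).comp x (hder₂ x hx hxZ)).hasDerivWithinAt (s := I ∩ Zᶜ)
    have hacc : UniqueDiffWithinAt ℝ (I ∩ Zᶜ) x :=
      uniqueDiffWithinAt_inter_compl_of_countable isOpen_Ioo hZc hx
    have heq : EqOn (A ∘ t₁) (A ∘ t₂) (I ∩ Zᶜ) := fun y hy => hAeq y hy.1 hy.2
    have h := hacc.eq_deriv _ d₁ (d₂.congr heq (heq ⟨hx, hxZ⟩))
    obtain ⟨hb1, hb2⟩ := (hcr x hx).2.1
    rw [hα1, div_one, hAeq x hx hxZ] at h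
    have hE := Real.exp_ne_zero (-A (t₂ x))
    field_simp at h
    linarith
  have hinj₁ : InjOn (fun x => expI (t₁ x)) I := fun x hx y hy hxy => by
    have h := congrArg G (expI_injOn (hcr x hx).1.1 (hcr y hy).1.1 hxy)
    rw [(hcr x hx).2.2.1.1, (hcr y hy).2.2.1.1] at h
    linarith
  have hinj₂ : InjOn (fun x => expI (t₂ x)) I := fun x hx y hy hxy => by
    have h := congrArg G (expI_injOn (hcr x hx).1.2.1 (hcr y hy).1.2.1 hxy)
    rw [(hcr x hx).2.2.2.2.1, (hcr y hy).2.2.2.2.1, hα1] at h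
    linarith
  refine ⟨hA2, fun ha0 => ?_, l, t₁, t₂, hne, tendsto_cofinite_of_injOn hinj₁ hlI hlc,
    tendsto_cofinite_of_injOn hinj₂ hlI hlc, ?_, hlim', ?_, ?_⟩
  · have hAz : ∀ t, A t = 0 := fun t => by simp [hAdef, ha0]
    simpa [hγ, hGdef, hAz] using hγ0
  · filter_upwards [hlI] with x hx
    exact (hcr x hx).1.2.2
  · filter_upwards [hlI, hlZ] with x hx hxZ
    rw [← intervalIntegral.integral_interval_sub_left (a := 0) (ha.intervalIntegrable _ _)
      (ha.intervalIntegrable _ _)]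
    exact sub_eq_zero.2 (hAeq x hx hxZ).symm
  · filter_upwards [hlI, hlZ] with x hx hxZ
    exact hab x hx hxZ

theorem IsSolution.neg {a b φ : ℝ → ℝ} (h : IsSolution a b φ) :
    IsSolution (fun t => -a t) (fun t => -b t) fun t => -φ t := fun t =>
  (h t).neg.congr_deriv (by rw [abs_neg]; ring)

/-- Negative initial values are reduced to positive ones by the symmetry
`(a, b, x) ↦ (-a, -b, -x)` of the equation. -/
theorem hasIdentifiedPairs_of_nonpos {a b : ℝ → ℝ} (ha : Continuous a) (hb : Continuous b)
    (hcenter : HasGlobalCenter a b) {x₁ x₂ : ℝ} (hx : x₁ < x₂) (hx₂ : x₂ ≤ 0) {t₁ t₂ : ℝ → ℝ}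
    (hsol : ∀ x ∈ Ioo x₁ x₂, ∃ φ : ℝ → ℝ, IsSolution a b φ ∧ φ 0 = x ∧
      HasExactlyTwoSimpleZeros φ (t₁ x) (t₂ x))
    (hlim : Tendsto (fun x => t₂ x - t₁ x) (𝓝[>] x₁) (𝓝 0) ∨
      Tendsto (fun x => t₂ x - t₁ x) (𝓝[<] x₂) (𝓝 0)) :
    (∫ r in 0..2 * Real.pi, a r = 0) ∧ ((∀ r, a r = 0) → ∫ r in 0..2 * Real.pi, b r = 0) ∧
      HasIdentifiedPairs a b := by
  have hcenter' : HasGlobalCenter (fun t => -a t) (fun t => -b t) := fun φ hφ => by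
    have h := hcenter _ (by simpa only [neg_neg] using hφ.neg)
    simpa using h
  obtain ⟨h1, h2, l, s, t, hne, hs, ht, hst, hl, h3, h4⟩ := hasIdentifiedPairs_of_nonneg ha.neg
    hb.neg hcenter' (neg_lt_neg hx) (neg_nonneg.2 hx₂) (t₁ := fun x => t₁ (-x))
    (t₂ := fun x => t₂ (-x)) (fun x hx => by
      obtain ⟨φ, hφ, hφ0, hst, hset, hds, hdt⟩ := hsol (-x)
        ⟨by linarith [hx.2], by linarith [hx.1]⟩
      refine ⟨fun t => -φ t, hφ.neg, by simp [hφ0], hst, by simpa using hset, ?_, ?_⟩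
      · simpa using hds
      · simpa using hdt)
    (by
      rcases hlim with h | h
      · right
        have := tendsto_neg_nhdsLT (a := -x₁)
        rw [neg_neg] at this
        exact h.comp this
      · left
        have := tendsto_neg_nhdsGT (a := -x₂)
        rw [neg_neg] at this
        exact h.comp this)
  refine ⟨by simpa using h1, fun h0 => by simpa using h2 (by simpa using h0), l, s, t, hne, hs, ht,
    hst, hl, ?_, ?_⟩
  · filter_upwards [h3] with i hi
    simpa using hi
  · filter_upwards [h4] with i hi
    simp only [Pi.neg_apply] at hi
    linarith

theorem TwoMergingZeros.hasIdentifiedPairs {a b : ℝ → ℝ} (ha : Continuous a) (hb : Continuous b)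
    (hcenter : HasGlobalCenter a b) (h : TwoMergingZeros a b) :
    (∫ r in 0..2 * Real.pi, a r = 0) ∧ ((∀ r, a r = 0) → ∫ r in 0..2 * Real.pi, b r = 0) ∧
      HasIdentifiedPairs a b := by
  obtain ⟨x₁, x₂, hx, t₁, t₂, hsol, hlim⟩ := h
  rcases hlim with hlim | hlim
  · rcases le_or_gt 0 x₁ with h0 | h0
    · exact hasIdentifiedPairs_of_nonneg ha hb hcenter hx h0 hsol (Or.inl hlim)
    · exact hasIdentifiedPairs_of_nonpos ha hb hcenter (lt_min hx h0) (min_le_right x₂ 0)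
        (fun x hx => hsol x ⟨hx.1, hx.2.trans_le (min_le_left _ _)⟩) (Or.inl hlim)
  · rcases le_or_gt x₂ 0 with h0 | h0
    · exact hasIdentifiedPairs_of_nonpos ha hb hcenter hx h0 hsol (Or.inr hlim)
    · exact hasIdentifiedPairs_of_nonneg ha hb hcenter (max_lt hx h0) (le_max_right x₁ 0)
        (fun x hx => hsol x ⟨(le_max_left _ _).trans_lt hx.1, hx.2⟩) (Or.inr hlim)

end Merging

/-! ### Global centers and the composition condition -/

/-- A trigonometric polynomial with mean value zero has a trigonometric antiderivative. -/
theorem IsTrigPoly.exists_antiderivative {a : ℝ → ℝ} (ha : IsTrigPoly a)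
    (h : ∫ r in 0..2 * Real.pi, a r = 0) :
    ∃ A, IsTrigPoly A ∧ ∀ t, HasDerivAt A (a t) t := by
  obtain ⟨A, c, hA, hAa⟩ := ha.exists_hasDerivAt
  have hc : Continuous a := ha.differentiable.continuous
  have h1 := intervalIntegral.integral_eq_sub_of_hasDerivAt (a := 0) (b := 2 * Real.pi)
    (fun t _ => hAa t) (Continuous.intervalIntegrable (by fun_prop) _ _)
  have hper : A (2 * Real.pi) = A 0 := by simpa using hA.periodic 0
  rw [intervalIntegral.integral_sub (hc.intervalIntegrable _ _) (by simp), h, hper, sub_self,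
    intervalIntegral.integral_const, smul_eq_mul, sub_zero, zero_sub, neg_eq_zero] at h1
  have hc0 : c = 0 := (mul_eq_zero.1 h1).resolve_left (by positivity)
  exact ⟨A, hA, fun t => by simpa [hc0] using hAa t⟩

theorem theorem1 (a b : ℝ → ℝ) (ha : IsTrigPoly a) (hb : IsTrigPoly b)
    (hb_simple : HasSimpleZeros b) (hyp : TwoMergingZeros a b) :
    HasGlobalCenter a b ↔ CompositionCondition a b := by
  refine ⟨fun hcenter => ?_, fun h => h.hasGlobalCenter ha⟩
  obtain ⟨hmean, hmeanb, l, s, t, hne, hs, ht, hst, hlim, hint, hab⟩ :=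
    hyp.hasIdentifiedPairs ha.differentiable.continuous hb.differentiable.continuous hcenter
  by_cases ha0 : ∀ r, a r = 0
  · obtain ⟨B, hB, hBb⟩ := hb.exists_antiderivative (hmeanb ha0)
    exact ⟨0, 1, B, hB, fun t => by simp [ha0, (hBb t).deriv]⟩
  push Not at ha0
  obtain ⟨A, hA, hAa⟩ := ha.exists_antiderivative hmean
  refine compositionCondition_of_identified hA hAa ha0 ha hb hs ht hst hlim ?_ hab
  filter_upwards [hint] with i hi
  rw [intervalIntegral.integral_eq_sub_of_hasDerivAt (fun t _ => hAa t)
    (ha.differentiable.continuous.intervalIntegrable _ _)] at hi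
  linarith
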